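/- **Setting.** A training set consists of $N\ge 1$ labelled unit vectors $(\phi_j,y_j)\in\mathbb R^D\times\{1,-1\}$. It is *separated by margin $\gamma>0$* if some unit vector $u$ satisfies $y_j\,u^T\phi_j\ge\gamma$ for all $j$. The perceptron with weights $w\in\mathbb R^D$ *misclassifies* $(\phi,y)$, written $f_w(\phi,y)=1$, if $y\,w^T\phi\le 0$. A training algorithm *fails* if it outputs weights that misclassify at least one training vector. *Quantum algorithms* act on an address register with orthonormal basis $u_1,\dots,u_N$ and a finite workspace. They may use arbitrary input-independent unitaries, state preparations, measurements and coin tosses, adaptively, and the following queries, each of cost one: the misclassification oracle $F_w:u_j\mapsto(-1)^{f_w(\phi_j,y_j)}u_j$, for any $w$ ($w$ may also be controlled by the workspace); coherent data access, i.e. a permutation of the workspace basis states that depends on $(\phi_j,y_j)$ and is controlled by the address $j$; and classical look-ups $j\mapsto(\phi_j,y_j)$. *Classical sampling algorithms* are adaptive and randomized; each query, of cost one, draws a fresh uniformly random training vector and returns it together with the value of $f_w$ on it, for a $w$ of the algorithm's choice. *The online quantum perceptron* with parameter $c\in(1,2)$ starts with $w=0$ and performs at most $\lfloor 1/\gamma^2\rfloor$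 rounds. A round with current weights $w$ runs, for $k=1,\dots,\lceil\log_{3/4}(\gamma^2\epsilon)\rceil$ and $j=1,\dots,\max\{1,\lceil\log_c(1/\sin(2\arcsin(1/\sqrt N)))\rceil\}$ (read as $j=1$ only, if $N=1$), the following attempt: draw $m$ uniformly from $\{0,\dots,\lceil c^j\rceil\}$; prepare $\Psi=N^{-1/2}\sum_j u_j$; apply $((2\Psi\Psi^\dagger-1)F_w)^m$; measure the address, with outcome $q$; look up $(\phi_q,y_q)$; if $f_w(\phi_q,y_q)=1$, replace $w$ by $w+y_q\phi_q$ and go to the next round. If no attempt of a round succeeds, the algorithm stops. It outputs the final $w$. **Theorem.** 1. For every $c\in(1,2)$ there is a constant $C>0$ such that, for all $N\ge1$, all $D$, all $\gamma>0$ and all $0<\epsilon<1$ with $\epsilon\gamma^2\le\frac12$, on every training set of $N$ unit vectors in $\mathbb R^D$ that is separated by margin $\gamma$, the online quantum perceptron always makes at most $C\,\frac{\sqrt N}{\gamma^2}\log\frac1{\epsilon\gamma^2}$ queries (applications of $F_w$ and look-ups together), and it fails with probability at most $\epsilon$. 2. For every $\epsilon_0<\frac12$ there is a constant $\kappa>0$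 such that the following holds for all $N\ge1$, $D\ge2$, $0<\gamma\le\frac1{\sqrt2}$ and $0<\epsilon\le\epsilon_0$. If a quantum algorithm fails with probability at most $\epsilon$ on every training set of $N$ unit vectors in $\mathbb R^D$ that is separated by margin $\gamma$, then on some such training set its expected (hence also its worst-case) number of queries is at least $\kappa\sqrt N$. 3. There is a constant $C>0$ such that, for all $N\ge1$, all $D$, all $\gamma>0$ and all $0<\epsilon<1$ with $\epsilon\gamma^2\le\frac12$, some classical sampling algorithm has the following property: on every training set of $N$ unit vectors in $\mathbb R^D$ that is separated by margin $\gamma$, it always makes at most $C\,\frac{N}{\gamma^2}\log\frac1{\epsilon\gamma^2}$ queries and fails with probability at most $\epsilon$. 4. For every $\epsilon_0<\frac12$ there is a constant $\kappa>0$ such that the following holds for all $N\ge1$, $D\ge2$, $0<\gamma\le\frac1{\sqrt2}$ and $0<\epsilon\le\epsilon_0$. If a classical sampling algorithm fails with probability at most $\epsilon$ on every training set of $N$ unit vectors in $\mathbb R^D$ that is separated by margin $\gamma$, then on some such training set its expected (hence also its worst-case) number of queries is at least $\kappa N$. -/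

import Mathlib

noncomputable section

namespace QuantumPerceptron

/-! ### Perceptrons -/

/-- Feature vectors and perceptron weights. -/
abbrev Vec (D : ℕ) : Type := EuclideanSpace ℝ (Fin D)

/-- A labelled training vector `(φ, y)` with `y ∈ {1, -1}`. -/
abbrev Example (D : ℕ) : Type := Vec D × ℤˣ

/-- The label as a real number. -/
def label {D : ℕ} (x : Example D) : ℝ := ((x.2 : ℤ) : ℝ)

/-- `f_w(φ, y) = 1`: the perceptron with weights `w` fails to satisfy `y * ⟪w, φ⟫ > 0`. -/
def Misclassifies {D : ℕ} (w : Vec D) (x : Example D) : Prop :=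
  label x * inner ℝ w x.1 ≤ 0

/-- The training set consists of unit vectors, and the two classes are separated with
margin (at least) `γ` by some hyperplane with unit normal `u`. -/
def UnitWithMargin {N D : ℕ} (γ : ℝ) (d : Fin N → Example D) : Prop :=
  (∀ i, ‖(d i).1‖ = 1) ∧ ∃ u : Vec D, ‖u‖ = 1 ∧ ∀ i, γ ≤ label (d i) * inner ℝ u (d i).1

/-- The weights that misclassify at least one training vector. -/
def badWeights {N D : ℕ} (d : Fin N → Example D) : Set (Vec D) :=
  {w | ∃ j, Misclassifies w (d j)}

/-- The perceptron update `w ← w + y φ`. -/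
def update {D : ℕ} (w : Vec D) (x : Example D) : Vec D := w + label x • x.1

/-! ### Quantum algorithms with oracle access to a training set -/

/-- State vectors of an address register with basis `u_1, …, u_N` and a finite
workspace with basis `W`. -/
abbrev State (N : ℕ) (W : Type) : Type := EuclideanSpace ℂ (Fin N × W)

/-- Adaptive quantum algorithms with access to a training set of `N` labelled vectors in
`ℝ ^ D`. Later instructions may depend on all measurement outcomes, coin tosses and
answers of classical look-ups obtained so far.
* `output w`: stop with the weights `w`;
* `unitary V`: apply a unitary that does not depend on the training set;
* `prepare χ`: discard the register and prepare the unit vector `χ` instead;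
* `measure lab`: projective measurement, where `lab` gives the outcome for each basis vector
  (a measurement in another basis is obtained by applying a unitary first);
* `toss p`: a random variable with finitely many values and law `p`;
* `applyF w`: one application of the misclassification oracle `F_w`, where `w` may be controlled
  by the workspace (a constant function `w` gives `F_w` itself);
* `applyU g`: one coherent access to the training data, the unitary that applies to the workspace
  the permutation `g (φ_j, y_j)` of its basis, controlled by the address `j`; loading data into a
  blank memory and unloading it are special cases;
* `lookup j`: one classical query `U^c(j)`, with answer `(φ_j, y_j)`. -/
inductive QProg (N D : ℕ) (W : Type) [Fintype W] : Type
  | output (w : Vec D) : QProg N D W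
  | unitary (V : State N W ≃ₗᵢ[ℂ] State N W) (next : QProg N D W) : QProg N D W
  | prepare (χ : State N W) (hχ : ‖χ‖ = 1) (next : QProg N D W) : QProg N D W
  | measure (k : ℕ) (lab : Fin N × W → Fin k) (next : Fin k → QProg N D W) : QProg N D W
  | toss (n : ℕ) (p : stdSimplex ℝ (Fin n)) (next : Fin n → QProg N D W) : QProg N D W
  | applyF (w : W → Vec D) (next : QProg N D W) : QProg N D W
  | applyU (g : Example D → Equiv.Perm W) (next : QProg N D W) : QProg N D W
  | lookup (j : Fin N) (next : Example D → QProg N D W) : QProg N D W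

open Classical in
/-- `F_w` for the training set `d`: the basis vector `u_j ⊗ s` is multiplied by `-1` exactly when
the weights `w s` misclassify the `j`-th training vector. -/
def oracleF {N D : ℕ} {W : Type} (d : Fin N → Example D) (w : W → Vec D) (ψ : State N W) :
    State N W :=
  WithLp.toLp 2 fun x => (if Misclassifies (w x.2) (d x.1) then -1 else 1) * ψ x

/-- The data access unitary `u_j ⊗ s ↦ u_j ⊗ g (φ_j, y_j) s`. -/
def oracleU {N D : ℕ} {W : Type} (d : Fin N → Example D) (g : Example D → Equiv.Perm W)
    (ψ : State N W) : State N W :=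
  WithLp.toLp 2 fun x => ψ (x.1, (g (d x.1)).symm x.2)

/-- Projection onto the span of the basis vectors with label `l`. -/
def project {N k : ℕ} {W : Type} (lab : Fin N × W → Fin k) (l : Fin k) (ψ : State N W) :
    State N W :=
  WithLp.toLp 2 fun x => if lab x = l then ψ x else 0

namespace QProg

open Classical in
/-- The probability that the algorithm outputs weights in `G` when it is run on the training set
`d`, started in the state `ψ`. States are not renormalized after a measurement: by Born's rule,
`‖ψ‖ ^ 2` is the probability of the measurement outcomes that led to `ψ`. -/
def outputProb {N D : ℕ} {W : Type} [Fintype W] (d : Fin N → Example D) (G : Set (Vec D)) :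
    QProg N D W → State N W → ℝ
  | output w, ψ => if w ∈ G then ‖ψ‖ ^ 2 else 0
  | unitary V next, ψ => outputProb d G next (V ψ)
  | prepare χ _ next, ψ => ‖ψ‖ ^ 2 * outputProb d G next χ
  | measure _ lab next, ψ => ∑ l, outputProb d G (next l) (project lab l ψ)
  | toss _ p next, ψ => ∑ i, p.1 i * outputProb d G (next i) ψ
  | applyF w next, ψ => outputProb d G next (oracleF d w ψ)
  | applyU g next, ψ => outputProb d G next (oracleU d g ψ)
  | lookup j next, ψ => outputProb d G (next (d j)) ψ

/-- The largest total number of queries (`applyF`, `applyU` and `lookup`) made on the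
training set `d`, over all measurement outcomes and coin tosses. -/
def maxQueries {N D : ℕ} {W : Type} [Fintype W] (d : Fin N → Example D) : QProg N D W → ℕ
  | output _ => 0
  | unitary _ next => maxQueries d next
  | prepare _ _ next => maxQueries d next
  | measure _ _ next => Finset.univ.sup fun l => maxQueries d (next l)
  | toss _ _ next => Finset.univ.sup fun i => maxQueries d (next i)
  | applyF _ next => maxQueries d next + 1
  | applyU _ next => maxQueries d next + 1
  | lookup j next => maxQueries d (next (d j)) + 1

/-- The expected total number of queries (`applyF`, `applyU` and `lookup`) made on the training set
`d` from the state `ψ`, with the same convention on states as in `outputProb`. -/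
def expectedQueries {N D : ℕ} {W : Type} [Fintype W] (d : Fin N → Example D) :
    QProg N D W → State N W → ℝ
  | output _, _ => 0
  | unitary V next, ψ => expectedQueries d next (V ψ)
  | prepare χ _ next, ψ => ‖ψ‖ ^ 2 * expectedQueries d next χ
  | measure _ lab next, ψ => ∑ l, expectedQueries d (next l) (project lab l ψ)
  | toss _ p next, ψ => ∑ i, p.1 i * expectedQueries d (next i) ψ
  | applyF w next, ψ => ‖ψ‖ ^ 2 + expectedQueries d next (oracleF d w ψ)
  | applyU g next, ψ => ‖ψ‖ ^ 2 + expectedQueries d next (oracleU d g ψ)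
  | lookup j next, ψ => ‖ψ‖ ^ 2 + expectedQueries d (next (d j)) ψ

end QProg

/-! ### The online quantum perceptron -/

/-- The uniform superposition `Ψ = N^(-1/2) ∑ u_j` of all addresses. -/
def uniformState (N : ℕ) : State N Unit := WithLp.toLp 2 fun _ => ((√(N : ℝ))⁻¹ : ℝ)

theorem norm_uniformState (N : ℕ) [NeZero N] : ‖uniformState N‖ = 1 := by
  have h : (N : ℝ) ≠ 0 := Nat.cast_ne_zero.mpr (NeZero.ne N)
  have h0 : (0 : ℝ) ≤ N := Nat.cast_nonneg N
  rw [EuclideanSpace.norm_eq, Real.sqrt_eq_one]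
  simp only [uniformState, Complex.norm_real, Real.norm_eq_abs, sq_abs, inv_pow, Real.sq_sqrt h0,
    Finset.sum_const, Finset.card_univ, Fintype.card_prod, Fintype.card_fin, Fintype.card_unit,
    mul_one, nsmul_eq_mul]
  exact mul_inv_cancel₀ h

/-- The reflection `2 Ψ Ψ† - 1`. -/
def reflectUniform (N : ℕ) : State N Unit ≃ₗᵢ[ℂ] State N Unit :=
  (Submodule.span ℂ {uniformState N}).reflection

/-- Apply `((2 Ψ Ψ† - 1) F_w) ^ m` to the current state and continue with `next`. -/
def groverSteps {N D : ℕ} (w : Vec D) : ℕ → QProg N D Unit → QProg N D Unit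
  | 0, next => next
  | m + 1, next => .applyF (fun _ => w) (.unitary (reflectUniform N) (groverSteps w m next))

open Classical in
/-- One search attempt: draw `m` uniformly from `{0, …, M}`, prepare `Ψ`, apply `m` Grover
iterations, measure the address, look up the training vector found there, and continue with
`found` if it is misclassified, with `next` otherwise. -/
def attempt {N D : ℕ} [NeZero N] (w : Vec D) (M : ℕ) (found : Example D → QProg N D Unit)
    (next : QProg N D Unit) : QProg N D Unit :=
  .toss (M + 1) stdSimplex.barycenter fun m =>
    .prepare (uniformState N) (norm_uniformState N) <|
      groverSteps w m <|
        .measure N Prod.fst fun q =>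
          .lookup q fun x => if Misclassifies w x then found x else next

/-- Perform attempts with the parameters in the list until one of them succeeds. -/
def attempts {N D : ℕ} [NeZero N] (w : Vec D) (found : Example D → QProg N D Unit)
    (notFound : QProg N D Unit) : List ℕ → QProg N D Unit
  | [] => notFound
  | M :: Ms => attempt w M found (attempts w found notFound Ms)

/-- Number of iterations of the inner loop. Without the maximum, it would be `0` for `N = 2`, and
for `N = 1` the expression would involve a division by zero. -/
def innerLength (N : ℕ) (c : ℝ) : ℕ :=
  max 1 ⌈Real.logb c (1 / Real.sin (2 * Real.arcsin (1 / √(N : ℝ))))⌉₊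

/-- The two nested loops: `⌈log_{3/4} (γ² ε)⌉` repetitions of attempts with parameters `⌈c ^ j⌉`
for `j = 1, …, innerLength N c`. -/
def schedule (N : ℕ) (c γ ε : ℝ) : List ℕ :=
  (List.replicate ⌈Real.logb (3 / 4) (γ ^ 2 * ε)⌉₊
    ((List.range' 1 (innerLength N c)).map fun j => ⌈c ^ j⌉₊)).flatten

/-- At most `n` rounds of the online quantum perceptron, starting from the weights `w`. Each round
either finds a misclassified vector and updates the weights, or reports that no vector is
misclassified, in which case the training ends. -/
def train {N D : ℕ} [NeZero N] (c γ ε : ℝ) : ℕ → Vec D → QProg N D Unit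
  | 0, w => .output w
  | n + 1, w =>
    attempts w (fun x => train c γ ε n (update w x)) (.output w) (schedule N c γ ε)

/-- The online quantum perceptron: at most `1 / γ²` rounds, starting from the weights `0`. -/
def onlineQuantumPerceptron (N D : ℕ) [NeZero N] (c γ ε : ℝ) : QProg N D Unit :=
  train c γ ε ⌊1 / γ ^ 2⌋₊ 0

/-! ### Classical algorithms that sample the training set uniformly -/

/-- Adaptive randomized classical algorithms.
* `output w`: stop with the weights `w`;
* `toss p`: a random variable with finitely many values and law `p`;
* `query w`: draw a fresh, uniformly distributed training vector `(φ, y)` and query `f_w(φ, y)`;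
  the answer consists of `(φ, y)` and this value. -/
inductive CProg (D : ℕ) : Type
  | output (w : Vec D) : CProg D
  | toss (n : ℕ) (p : stdSimplex ℝ (Fin n)) (next : Fin n → CProg D) : CProg D
  | query (w : Vec D) (next : Example D → Bool → CProg D) : CProg D

namespace CProg

open Classical in
/-- The probability that the algorithm outputs weights in `G` on the training set `d`. -/
def outputProb {N D : ℕ} (d : Fin N → Example D) (G : Set (Vec D)) : CProg D → ℝ
  | output w => if w ∈ G then 1 else 0
  | toss _ p next => ∑ i, p.1 i * outputProb d G (next i)
  | query w next =>
    (∑ i, outputProb d G (next (d i) (decide (Misclassifies w (d i))))) / (N : ℝ)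

open Classical in
/-- The largest number of queries made on the training set `d`, over all samples and tosses. -/
def maxQueries {N D : ℕ} (d : Fin N → Example D) : CProg D → ℕ
  | output _ => 0
  | toss _ _ next => Finset.univ.sup fun i => maxQueries d (next i)
  | query w next =>
    (Finset.univ.sup fun i => maxQueries d (next (d i) (decide (Misclassifies w (d i))))) + 1

open Classical in
/-- The expected number of queries made on the training set `d`. -/
def expectedQueries {N D : ℕ} (d : Fin N → Example D) : CProg D → ℝ
  | output _ => 0
  | toss _ p next => ∑ i, p.1 i * expectedQueries d (next i)
  | query w next =>
    1 + (∑ i, expectedQueries d (next (d i) (decide (Misclassifies w (d i))))) / (N : ℝ)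

end CProg

end QuantumPerceptron

end

open QuantumPerceptron

noncomputable section

namespace QuantumPerceptron

/-! ### General facts about quantum programs -/

section Quantum

variable {N D : ℕ} {W : Type} [Fintype W]

/-! Lower bounds. All hard sets consist of copies of `(e₀, 1)`, with at most one member replaced by
`(e₁, 1)` or `(e₁, -1)`. Weights that are correct on a replaced set must have their `e₁`-coordinate
strictly of the sign of the replaced label. On the constant set one of the two complementary events
"coordinate positive" and "coordinate nonpositive" has probability at most `1/2`, so for one of the
labels a reliable algorithm has to behave differently as soon as one unknown address is changed.
Classically a change at one address is seen with probability at most (expected number of samples)`/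
N` (`CProg.outputProb_sub_le`). For quantum algorithms the overlap of the two runs is followed
(`QProg.re_inner_le`). A coherent query changes it only through the component at the changed address
`j`. With AM-GM at scale `t = √N`, the cost is `√N` times the query weight at `j` on the constant
set plus `1/√N` times all queries on the changed set. Averaging over `j` turns the weight at `j`
into the total divided by `N`, hence a bound of order `√N` for one of the sets. Square-root
fidelities are replaced by linear upper bounds with free parameters, so that the inequality adds up
over measurement branches and coin tosses and an induction over the program proves it for expected
query numbers. Upper bounds. Novikoff's argument allows at most `⌊1/γ²⌋` updates (`UpdateBound`), so
it suffices that each round overlooks an existing misclassified vector with probability at most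
`εγ²`. Classical sampling overlooks it `K` times with probability at most `(1 - 1/N)^K ≤ exp(-K/N)`.
For Grover search the state stays in a plane and rotates by `2θ` per iteration, where `sin² θ` is
the misclassified fraction; averaging over a random number of iterations gives success probability
at least `1/4` once the range is of order `√N` (`missProb_le_of_misclassifies`). The iteration
ranges in a block grow geometrically, so a block costs `O(√N)`, and logarithmically many blocks
suffice. -/

theorem norm_sq_eq_sum (ψ : State N W) : ‖ψ‖ ^ 2 = ∑ x, ‖ψ x‖ ^ 2 :=
  EuclideanSpace.norm_sq_eq ψ

theorem norm_oracleF (d : Fin N → Example D) (w : W → Vec D) (ψ : State N W) :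
    ‖oracleF d w ψ‖ = ‖ψ‖ := by
  rw [EuclideanSpace.norm_eq, EuclideanSpace.norm_eq]
  congr 1
  refine Finset.sum_congr rfl fun x _ => ?_
  simp only [oracleF]
  split_ifs <;> simp

theorem norm_oracleU (d : Fin N → Example D) (g : Example D → Equiv.Perm W) (ψ : State N W) :
    ‖oracleU d g ψ‖ = ‖ψ‖ := by
  rw [EuclideanSpace.norm_eq, EuclideanSpace.norm_eq]
  congr 1
  simp only [oracleU, Fintype.sum_prod_type]
  exact Finset.sum_congr rfl fun i _ =>
    Equiv.sum_comp (g (d i)).symm fun s => ‖ψ (i, s)‖ ^ 2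

theorem sum_norm_sq_project {k : ℕ} (lab : Fin N × W → Fin k) (ψ : State N W) :
    ∑ l, ‖project lab l ψ‖ ^ 2 = ‖ψ‖ ^ 2 := by
  simp only [norm_sq_eq_sum, project]
  rw [Finset.sum_comm]
  refine Finset.sum_congr rfl fun x _ => ?_
  rw [Finset.sum_eq_single (lab x)] <;> simp +contextual [eq_comm]

theorem sum_inner_project {k : ℕ} (lab : Fin N × W → Fin k) (ψ χ : State N W) :
    ∑ l, inner ℂ (project lab l ψ) (project lab l χ) = inner ℂ ψ χ := by
  simp only [PiLp.inner_apply, project]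
  rw [Finset.sum_comm]
  refine Finset.sum_congr rfl fun x _ => ?_
  rw [Finset.sum_eq_single (lab x)] <;> simp +contextual [eq_comm]

theorem QProg.outputProb_nonneg (d : Fin N → Example D) (G : Set (Vec D)) (A : QProg N D W)
    (ψ : State N W) : 0 ≤ A.outputProb d G ψ := by
  induction A generalizing ψ with
  | output w => simp only [outputProb]; split_ifs <;> positivity
  | unitary V next ih => exact ih _
  | prepare χ hχ next ih => exact mul_nonneg (sq_nonneg _) (ih _)
  | measure k lab next ih => exact Finset.sum_nonneg fun l _ => ih l _
  | toss n p next ih => exact Finset.sum_nonneg fun i _ => mul_nonneg (p.2.1 i) (ih i _)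
  | applyF w next ih => exact ih _
  | applyU g next ih => exact ih _
  | lookup j next ih => exact ih _ _

theorem QProg.outputProb_mono (d : Fin N → Example D) {G H : Set (Vec D)} (h : G ⊆ H)
    (A : QProg N D W) (ψ : State N W) : A.outputProb d G ψ ≤ A.outputProb d H ψ := by
  induction A generalizing ψ with
  | output w =>
    simp only [outputProb]
    split_ifs with h1 h2
    · exact le_rfl
    · exact absurd (h h1) h2
    · positivity
    · exact le_rfl
  | unitary V next ih => exact ih _
  | prepare χ hχ next ih => exact mul_le_mul_of_nonneg_left (ih _) (sq_nonneg _)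
  | measure k lab next ih => exact Finset.sum_le_sum fun l _ => ih l _
  | toss n p next ih =>
    exact Finset.sum_le_sum fun i _ => mul_le_mul_of_nonneg_left (ih i _) (p.2.1 i)
  | applyF w next ih => exact ih _
  | applyU g next ih => exact ih _
  | lookup j next ih => exact ih _ _

/-- Every instruction preserves the total squared norm, summed over branches; this is conservation
of probability for unnormalized states. -/
theorem QProg.outputProb_add_compl (d : Fin N → Example D) (G : Set (Vec D)) (A : QProg N D W)
    (ψ : State N W) : A.outputProb d G ψ + A.outputProb d Gᶜ ψ = ‖ψ‖ ^ 2 := by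
  induction A generalizing ψ with
  | output w => by_cases h : w ∈ G <;> simp [outputProb, h]
  | unitary V next ih => simp only [outputProb, ih, LinearIsometryEquiv.norm_map]
  | prepare χ hχ next ih => simp only [outputProb, ← mul_add, ih, hχ]; ring
  | measure k lab next ih =>
    simp only [outputProb, ← Finset.sum_add_distrib, ih, sum_norm_sq_project]
  | toss n p next ih =>
    simp only [outputProb, ← Finset.sum_add_distrib, ← mul_add, ih, ← Finset.sum_mul, p.2.2,
      one_mul]
  | applyF w next ih => simp only [outputProb, ih, norm_oracleF]
  | applyU g next ih => simp only [outputProb, ih, norm_oracleU]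
  | lookup j next ih => exact ih _ _

theorem QProg.expectedQueries_nonneg (d : Fin N → Example D) (A : QProg N D W)
    (ψ : State N W) : 0 ≤ A.expectedQueries d ψ := by
  induction A generalizing ψ with
  | output w => exact le_rfl
  | unitary V next ih => exact ih _
  | prepare χ hχ next ih => exact mul_nonneg (sq_nonneg _) (ih _)
  | measure k lab next ih => exact Finset.sum_nonneg fun l _ => ih l _
  | toss n p next ih => exact Finset.sum_nonneg fun i _ => mul_nonneg (p.2.1 i) (ih i _)
  | applyF w next ih => exact add_nonneg (sq_nonneg _) (ih _)
  | applyU g next ih => exact add_nonneg (sq_nonneg _) (ih _)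
  | lookup j next ih => exact add_nonneg (sq_nonneg _) (ih _ _)

/-- The expected number of queries to the address `j`; a coherent query in the state `ψ`
contributes the weight of `ψ` on the address `j`. -/
def QProg.queryWeight (d : Fin N → Example D) (j : Fin N) : QProg N D W → State N W → ℝ
  | output _, _ => 0
  | unitary V next, ψ => queryWeight d j next (V ψ)
  | prepare χ _ next, ψ => ‖ψ‖ ^ 2 * queryWeight d j next χ
  | measure _ lab next, ψ => ∑ l, queryWeight d j (next l) (project lab l ψ)
  | toss _ p next, ψ => ∑ i, p.1 i * queryWeight d j (next i) ψ
  | applyF w next, ψ => ‖project Prod.fst j ψ‖ ^ 2 + queryWeight d j next (oracleF d w ψ)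
  | applyU g next, ψ => ‖project Prod.fst j ψ‖ ^ 2 + queryWeight d j next (oracleU d g ψ)
  | lookup i next, ψ => (if i = j then ‖ψ‖ ^ 2 else 0) + queryWeight d j (next (d i)) ψ

theorem QProg.queryWeight_nonneg (d : Fin N → Example D) (j : Fin N) (A : QProg N D W)
    (ψ : State N W) : 0 ≤ A.queryWeight d j ψ := by
  induction A generalizing ψ with
  | output w => exact le_rfl
  | unitary V next ih => exact ih _
  | prepare χ hχ next ih => exact mul_nonneg (sq_nonneg _) (ih _)
  | measure k lab next ih => exact Finset.sum_nonneg fun l _ => ih l _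
  | toss n p next ih => exact Finset.sum_nonneg fun i _ => mul_nonneg (p.2.1 i) (ih i _)
  | applyF w next ih => exact add_nonneg (sq_nonneg _) (ih _)
  | applyU g next ih => exact add_nonneg (sq_nonneg _) (ih _)
  | lookup i next ih =>
    refine add_nonneg ?_ (ih _ _)
    split_ifs <;> positivity

/-- Each query has total weight `‖ψ‖ ^ 2`, distributed over the addresses. This is what makes the
weight at an average address only `1 / N` of the cost. -/
theorem QProg.sum_queryWeight (d : Fin N → Example D) (A : QProg N D W) (ψ : State N W) :
    ∑ j, A.queryWeight d j ψ = A.expectedQueries d ψ := by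
  induction A generalizing ψ with
  | output w => simp [queryWeight, expectedQueries]
  | unitary V next ih => simp only [queryWeight, expectedQueries, ih]
  | prepare χ hχ next ih => simp only [queryWeight, expectedQueries, ← Finset.mul_sum, ih]
  | measure k lab next ih =>
    simp only [queryWeight, expectedQueries]
    rw [Finset.sum_comm]
    simp only [ih]
  | toss n p next ih =>
    simp only [queryWeight, expectedQueries]
    rw [Finset.sum_comm]
    simp only [← Finset.mul_sum, ih]
  | applyF w next ih =>
    simp only [queryWeight, expectedQueries, Finset.sum_add_distrib, ih, sum_norm_sq_project]
  | applyU g next ih =>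
    simp only [queryWeight, expectedQueries, Finset.sum_add_distrib, ih, sum_norm_sq_project]
  | lookup i next ih =>
    simp [queryWeight, expectedQueries, Finset.sum_add_distrib, ih]

/-! ### Overlap of two runs on training sets that differ at one address -/

theorem norm_project_le {k : ℕ} (lab : Fin N × W → Fin k) (l : Fin k) (ψ : State N W) :
    ‖project lab l ψ‖ ≤ ‖ψ‖ := by
  refine le_of_sq_le_sq ?_ (norm_nonneg _)
  rw [← sum_norm_sq_project lab ψ]
  exact Finset.single_le_sum (f := fun l => ‖project lab l ψ‖ ^ 2) (fun _ _ => sq_nonneg _)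
    (Finset.mem_univ l)

/-- Isometries that respect the addresses and agree off the address `j` change inner products only
on the address `j`. -/
theorem re_inner_le_of_agree (U U' : State N W → State N W) (hU : ∀ ψ, ‖U ψ‖ = ‖ψ‖)
    (hU' : ∀ ψ, ‖U' ψ‖ = ‖ψ‖)
    (hp : ∀ i ψ, project Prod.fst i (U ψ) = U (project Prod.fst i ψ))
    (hp' : ∀ i ψ, project Prod.fst i (U' ψ) = U' (project Prod.fst i ψ)) {j : Fin N}
    (hj : ∀ i, i ≠ j → ∀ ψ χ : State N W,
      inner ℂ (U (project Prod.fst i ψ)) (U' (project Prod.fst i χ)) =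
        inner ℂ (project Prod.fst i ψ) (project Prod.fst i χ))
    {t : ℝ} (ht : 0 < t) (ψ χ : State N W) :
    2 * (inner ℂ ψ χ).re ≤ 2 * (inner ℂ (U ψ) (U' χ)).re
      + 2 * t * ‖project Prod.fst j ψ‖ ^ 2 + 2 * t⁻¹ * ‖χ‖ ^ 2 := by
  have h1 := sum_inner_project Prod.fst ψ χ
  have h2 := sum_inner_project Prod.fst (U ψ) (U' χ)
  -- Both inner products split over the addresses; all parts except the one at `j` coincide.
  rw [← Finset.add_sum_erase _ _ (Finset.mem_univ j)] at h1 h2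
  have h3 : ∑ i ∈ Finset.univ.erase j,
      inner ℂ (project Prod.fst i (U ψ)) (project Prod.fst i (U' χ)) =
      ∑ i ∈ Finset.univ.erase j, inner ℂ (project Prod.fst i ψ) (project Prod.fst i χ) := by
    refine Finset.sum_congr rfl fun i hi => ?_
    rw [hp, hp', hj i (Finset.ne_of_mem_erase hi)]
  rw [h3] at h2
  rw [← h1, ← h2, Complex.add_re, Complex.add_re, hp, hp']
  have h4 : (inner ℂ (project Prod.fst j ψ) (project Prod.fst j χ)).re ≤
      ‖project Prod.fst j ψ‖ * ‖χ‖ :=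
    ((Complex.re_le_norm _).trans (norm_inner_le_norm _ _)).trans
      (mul_le_mul_of_nonneg_left (norm_project_le _ _ _) (norm_nonneg _))
  have h5 : -(inner ℂ (U (project Prod.fst j ψ)) (U' (project Prod.fst j χ))).re ≤
      ‖project Prod.fst j ψ‖ * ‖χ‖ := by
    refine (neg_le_abs _).trans (((Complex.abs_re_le_norm _).trans (norm_inner_le_norm _ _)).trans ?_)
    rw [hU, hU']
    exact mul_le_mul_of_nonneg_left (norm_project_le _ _ _) (norm_nonneg _)
  have h6 : 2 * (‖project Prod.fst j ψ‖ * ‖χ‖) ≤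
      t * ‖project Prod.fst j ψ‖ ^ 2 + t⁻¹ * ‖χ‖ ^ 2 := by
    have h7 : t * ‖project Prod.fst j ψ‖ ^ 2 + t⁻¹ * ‖χ‖ ^ 2 -
        2 * (‖project Prod.fst j ψ‖ * ‖χ‖) = t⁻¹ * (t * ‖project Prod.fst j ψ‖ - ‖χ‖) ^ 2 := by
      field_simp
      ring
    have h8 : 0 ≤ t⁻¹ * (t * ‖project Prod.fst j ψ‖ - ‖χ‖) ^ 2 := by positivity
    linarith
  linarith

theorem re_inner_oracleF_le {d d' : Fin N → Example D} {j : Fin N} (h : ∀ i, i ≠ j → d i = d' i)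
    (w : W → Vec D) {t : ℝ} (ht : 0 < t) (ψ χ : State N W) :
    2 * (inner ℂ ψ χ).re ≤ 2 * (inner ℂ (oracleF d w ψ) (oracleF d' w χ)).re
      + 2 * t * ‖project Prod.fst j ψ‖ ^ 2 + 2 * t⁻¹ * ‖χ‖ ^ 2 := by
  refine re_inner_le_of_agree _ _ (norm_oracleF d w) (norm_oracleF d' w) ?_ ?_ ?_ ht ψ χ
  · intro i ψ; ext x; simp [project, oracleF]
  · intro i ψ; ext x; simp [project, oracleF]
  · intro i hi ψ χ
    simp only [PiLp.inner_apply, project, oracleF]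
    refine Finset.sum_congr rfl fun x _ => ?_
    by_cases hx : x.1 = i
    · rw [h x.1 (hx ▸ hi)]
      split_ifs <;> simp
    · simp [hx]

theorem re_inner_oracleU_le {d d' : Fin N → Example D} {j : Fin N} (h : ∀ i, i ≠ j → d i = d' i)
    (g : Example D → Equiv.Perm W) {t : ℝ} (ht : 0 < t) (ψ χ : State N W) :
    2 * (inner ℂ ψ χ).re ≤ 2 * (inner ℂ (oracleU d g ψ) (oracleU d' g χ)).re
      + 2 * t * ‖project Prod.fst j ψ‖ ^ 2 + 2 * t⁻¹ * ‖χ‖ ^ 2 := by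
  refine re_inner_le_of_agree _ _ (norm_oracleU d g) (norm_oracleU d' g) ?_ ?_ ?_ ht ψ χ
  · intro i ψ; ext x; simp [project, oracleU]
  · intro i ψ; ext x; simp [project, oracleU]
  · intro i hi ψ χ
    simp only [PiLp.inner_apply, project, oracleU, Fintype.sum_prod_type]
    refine Finset.sum_congr rfl fun k _ => ?_
    by_cases hk : k = i
    · simp only [hk, h i hi, if_true]
      exact Equiv.sum_comp (g (d' i)).symm fun s => inner ℂ (ψ (i, s)) (χ (i, s))
    · simp [hk]

/-- Two runs on training sets that differ only at the address `j` have similar output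
distributions, unless `j` is queried: a bound for the overlap of the initial states by
(linearized) fidelities of the outputs and the query weight at `j`. -/
theorem QProg.re_inner_le {d d' : Fin N → Example D} {j : Fin N} (h : ∀ i, i ≠ j → d i = d' i)
    (G : Set (Vec D)) (A : QProg N D W) (ψ χ : State N W) {r s t : ℝ} (hr : 0 < r) (hs : 0 < s)
    (ht : 0 < t) :
    2 * (inner ℂ ψ χ).re ≤
      r * A.outputProb d G ψ + r⁻¹ * A.outputProb d' G χ +
      (s * A.outputProb d Gᶜ ψ + s⁻¹ * A.outputProb d' Gᶜ χ) +
      (2 * t * A.queryWeight d j ψ + 2 * t⁻¹ * A.expectedQueries d' χ) := by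
  have amgm : ∀ (u : ℝ), 0 < u → ∀ ψ χ : State N W,
      2 * (inner ℂ ψ χ).re ≤ u * ‖ψ‖ ^ 2 + u⁻¹ * ‖χ‖ ^ 2 := by
    intro u hu ψ χ
    have h1 : (inner ℂ ψ χ).re ≤ ‖ψ‖ * ‖χ‖ :=
      (Complex.re_le_norm _).trans (norm_inner_le_norm _ _)
    have h2 : u * ‖ψ‖ ^ 2 + u⁻¹ * ‖χ‖ ^ 2 - 2 * (‖ψ‖ * ‖χ‖) = u⁻¹ * (u * ‖ψ‖ - ‖χ‖) ^ 2 := by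
      field_simp
      ring
    have h3 : 0 ≤ u⁻¹ * (u * ‖ψ‖ - ‖χ‖) ^ 2 := by positivity
    linarith
  -- The parameters `r`, `s`, `t` must vary in the induction, since `prepare` rescales them.
  induction A generalizing ψ χ r s t with
  | output w =>
    simp only [outputProb, queryWeight, expectedQueries, Set.mem_compl_iff]
    by_cases hw : w ∈ G
    · simpa [hw] using amgm r hr ψ χ
    · simpa [hw] using amgm s hs ψ χ
  | unitary V next ih =>
    rw [← V.inner_map_map ψ χ]
    exact ih _ _ hr hs ht
  | prepare ξ hξ next ih =>
    simp only [outputProb, queryWeight, expectedQueries]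
    have h1 : 2 * (inner ℂ ψ χ).re ≤ 2 * (‖ψ‖ * ‖χ‖) := by
      have := (Complex.re_le_norm _).trans (norm_inner_le_norm (𝕜 := ℂ) ψ χ)
      linarith
    have n1 := outputProb_nonneg d G next ξ
    have n2 := outputProb_nonneg d' G next ξ
    have n3 := outputProb_nonneg d Gᶜ next ξ
    have n4 := outputProb_nonneg d' Gᶜ next ξ
    have n5 := queryWeight_nonneg d j next ξ
    have n6 := expectedQueries_nonneg d' next ξ
    by_cases h0 : ‖ψ‖ * ‖χ‖ = 0
    · rw [h0] at h1
      refine h1.trans (le_of_eq_of_le (mul_zero 2) ?_)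
      positivity
    have hψ : 0 < ‖ψ‖ := (norm_nonneg _).lt_of_ne' (left_ne_zero_of_mul h0)
    have hχ : 0 < ‖χ‖ := (norm_nonneg _).lt_of_ne' (right_ne_zero_of_mul h0)
    have hq : 0 < ‖ψ‖ / ‖χ‖ := div_pos hψ hχ
    -- Both runs continue from the same unit vector `ξ`. Scaling the parameters by `‖ψ‖ / ‖χ‖` and
    -- multiplying the inequality by `‖ψ‖ * ‖χ‖` restores the separate weights `‖ψ‖ ^ 2` and `‖χ‖ ^
    -- 2`.
    have h2 := ih ξ ξ (mul_pos hr hq) (mul_pos hs hq) (mul_pos ht hq)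
    have h3 : (inner ℂ ξ ξ).re = 1 := by
      rw [inner_self_eq_norm_sq_to_K, hξ]; simp
    rw [h3] at h2
    have h4 := mul_le_mul_of_nonneg_left h2 (mul_pos hψ hχ).le
    refine h1.trans (le_of_eq_of_le (by ring) (h4.trans (le_of_eq ?_)))
    field_simp
  | measure k lab next ih =>
    simp only [outputProb, queryWeight, expectedQueries, Finset.mul_sum, ← Finset.sum_add_distrib]
    rw [← sum_inner_project lab ψ χ, Complex.re_sum, Finset.mul_sum]
    exact Finset.sum_le_sum fun l _ => ih l _ _ hr hs ht
  | toss n p next ih =>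
    simp only [outputProb, queryWeight, expectedQueries, Finset.mul_sum, ← Finset.sum_add_distrib]
    have h1 : 2 * (inner ℂ ψ χ).re = ∑ i, p.1 i * (2 * (inner ℂ ψ χ).re) := by
      rw [← Finset.sum_mul, p.2.2, one_mul]
    rw [h1]
    refine Finset.sum_le_sum fun i _ => ?_
    have := mul_le_mul_of_nonneg_left (ih i ψ χ hr hs ht) (p.2.1 i)
    refine this.trans (le_of_eq (by ring))
  | applyF w next ih =>
    simp only [outputProb, queryWeight, expectedQueries]
    have h1 := re_inner_oracleF_le h w ht ψ χ
    have h2 := ih (oracleF d w ψ) (oracleF d' w χ) hr hs ht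
    linarith
  | applyU g next ih =>
    simp only [outputProb, queryWeight, expectedQueries]
    have h1 := re_inner_oracleU_le h g ht ψ χ
    have h2 := ih (oracleU d g ψ) (oracleU d' g χ) hr hs ht
    linarith
  | lookup i next ih =>
    simp only [outputProb, queryWeight, expectedQueries]
    by_cases hi : i = j
    -- After a look-up at `j` the two programs may continue differently, so the induction hypothesis
    -- is of no use; the cost of this one query already pays for the whole overlap.
    · rw [if_pos hi]
      have n1 := mul_nonneg hr.le (outputProb_nonneg d G (next (d i)) ψ)
      have n2 := mul_nonneg (inv_pos.2 hr).le (outputProb_nonneg d' G (next (d' i)) χ)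
      have n3 := mul_nonneg hs.le (outputProb_nonneg d Gᶜ (next (d i)) ψ)
      have n4 := mul_nonneg (inv_pos.2 hs).le (outputProb_nonneg d' Gᶜ (next (d' i)) χ)
      have n5 := mul_nonneg ht.le (queryWeight_nonneg d j (next (d i)) ψ)
      have n6 := mul_nonneg (inv_pos.2 ht).le (expectedQueries_nonneg d' (next (d' i)) χ)
      have n7 : 0 ≤ t * ‖ψ‖ ^ 2 := by positivity
      have n8 : 0 ≤ t⁻¹ * ‖χ‖ ^ 2 := by positivity
      have := amgm t ht ψ χ
      linarith
    · rw [if_neg hi, h i hi]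
      have n8 : 0 ≤ t⁻¹ * ‖χ‖ ^ 2 := by positivity
      have := ih (d' i) ψ χ hr hs ht
      linarith

/-- A quantum algorithm whose output lies in `G` with probability at most `1 / 2` on `d` and at least
`1 / 2 + δ` on training sets `d' j` that differ from `d` only at `j` makes `Ω(√N)` queries. -/
theorem QProg.exists_expectedQueries_ge (hN : 1 ≤ N) {d : Fin N → Example D}
    {d' : Fin N → Fin N → Example D} (h : ∀ j i, i ≠ j → d i = d' j i) (G : Set (Vec D)) {δ : ℝ}
    (hδ : 0 < δ) (hδ1 : δ < 1) (A : QProg N D W) (ψ : State N W) (hψ : ‖ψ‖ = 1)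
    (hd : A.outputProb d G ψ ≤ 1 / 2) (hd' : ∀ j, A.outputProb (d' j) Gᶜ ψ ≤ 1 / 2 - δ) :
    δ ^ 2 / 4 * √(N : ℝ) ≤ A.expectedQueries d ψ ∨
      ∃ j, δ ^ 2 / 4 * √(N : ℝ) ≤ A.expectedQueries (d' j) ψ := by
  by_contra! hcon
  obtain ⟨hc, hc'⟩ := hcon
  have hN' : (0 : ℝ) < N := by exact_mod_cast hN
  have hS : 0 < √(N : ℝ) := Real.sqrt_pos.2 hN'
  have hSS : √(N : ℝ) * √(N : ℝ) = N := Real.mul_self_sqrt hN'.le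
  have key : ∀ j, δ ^ 2 ≤ 2 * √(N : ℝ) * A.queryWeight d j ψ +
      2 * (√(N : ℝ))⁻¹ * A.expectedQueries (d' j) ψ := by
    intro j
    -- At `r = 1 + δ`, `s = 1 - δ` the output terms of `d` are at most `1` and those of `d' j` at
    -- most `(1 - 2δ²)/(1 - δ²) ≤ 1 - δ²`, while the overlap term is `2`. The gap `δ²` must come
    -- from queries. The scale `t = √N` balances the weight at `j`, which is small on average,
    -- against all queries on `d' j`, which may concentrate at `j`.
    have h1 := QProg.re_inner_le (h j) G A ψ ψ (r := 1 + δ) (s := 1 - δ) (by linarith)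
      (by linarith) hS
    have h2 : (inner ℂ ψ ψ).re = 1 := by
      rw [inner_self_eq_norm_sq_to_K, hψ]; simp
    rw [h2] at h1
    have h3 := outputProb_add_compl d G A ψ
    have h4 := outputProb_add_compl (d' j) G A ψ
    rw [hψ] at h3 h4
    have h5 : (1 + δ) * A.outputProb d G ψ + (1 - δ) * A.outputProb d Gᶜ ψ ≤ 1 := by
      nlinarith
    have h6 : (1 + δ)⁻¹ * A.outputProb (d' j) G ψ + (1 - δ)⁻¹ * A.outputProb (d' j) Gᶜ ψ ≤
        1 - δ ^ 2 := by
      set q := A.outputProb (d' j) Gᶜ ψ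
      have h7 : A.outputProb (d' j) G ψ = 1 - q := by linarith
      rw [h7]
      have h8 : (1 + δ)⁻¹ * (1 - q) + (1 - δ)⁻¹ * q =
          (1 - δ + 2 * δ * q) / ((1 + δ) * (1 - δ)) := by
        have : 1 + δ ≠ 0 := by linarith
        have : 1 - δ ≠ 0 := by linarith
        field_simp
        ring
      rw [h8, div_le_iff₀ (mul_pos (by linarith) (by linarith))]
      nlinarith [mul_le_mul_of_nonneg_left (hd' j) hδ.le, pow_pos hδ 4]
    linarith
  -- Summed over `j`, the left side is `N δ²`, while each of the two groups on the right would be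
  -- below `N δ² / 2`.
  have hsum := Finset.sum_le_sum fun j (_ : j ∈ Finset.univ) => key j
  rw [Finset.sum_add_distrib, ← Finset.mul_sum, ← Finset.mul_sum, sum_queryWeight,
    Finset.sum_const, Finset.card_univ, Fintype.card_fin, nsmul_eq_mul] at hsum
  have h1 : ∑ j, A.expectedQueries (d' j) ψ < N * (δ ^ 2 / 4 * √(N : ℝ)) := by
    have : NeZero N := ⟨by omega⟩
    calc _ < ∑ _j : Fin N, δ ^ 2 / 4 * √(N : ℝ) :=
          Finset.sum_lt_sum_of_nonempty Finset.univ_nonempty fun j _ => hc' j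
      _ = _ := by simp
  have h2 := mul_lt_mul_of_pos_left hc (mul_pos two_pos hS)
  have h3 := mul_lt_mul_of_pos_left h1 (mul_pos two_pos (inv_pos.2 hS))
  have h4 : 2 * (√(N : ℝ))⁻¹ * (N * (δ ^ 2 / 4 * √(N : ℝ))) = N * δ ^ 2 / 2 := by
    field_simp
    ring
  have h5 : 2 * √(N : ℝ) * (δ ^ 2 / 4 * √(N : ℝ)) = N * δ ^ 2 / 2 := by
    linear_combination (δ ^ 2 / 2) * hSS
  linarith

end Quantum

/-! ### General facts about classical programs -/

section Classical

variable {N D : ℕ}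

theorem sum_div_card [NeZero N] (a : ℝ) : (∑ _i : Fin N, a) / (N : ℝ) = a := by
  have : (N : ℝ) ≠ 0 := Nat.cast_ne_zero.mpr (NeZero.ne N)
  simp only [Finset.sum_const, Finset.card_univ, Fintype.card_fin, nsmul_eq_mul]
  field_simp

theorem CProg.outputProb_nonneg (d : Fin N → Example D) (G : Set (Vec D)) (A : CProg D) :
    0 ≤ A.outputProb d G := by
  induction A with
  | output w => simp only [outputProb]; split_ifs <;> norm_num
  | toss n p next ih => exact Finset.sum_nonneg fun i _ => mul_nonneg (p.2.1 i) (ih i)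
  | query w next ih =>
    exact div_nonneg (Finset.sum_nonneg fun i _ => ih _ _) (Nat.cast_nonneg _)

theorem CProg.outputProb_mono (d : Fin N → Example D) {G H : Set (Vec D)} (h : G ⊆ H)
    (A : CProg D) : A.outputProb d G ≤ A.outputProb d H := by
  induction A with
  | output w =>
    simp only [outputProb]
    split_ifs with h1 h2
    · exact le_rfl
    · exact absurd (h h1) h2
    · norm_num
    · exact le_rfl
  | toss n p next ih =>
    exact Finset.sum_le_sum fun i _ => mul_le_mul_of_nonneg_left (ih i) (p.2.1 i)
  | query w next ih =>
    exact div_le_div_of_nonneg_right (Finset.sum_le_sum fun i _ => ih _ _) (Nat.cast_nonneg _)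

theorem CProg.outputProb_add_compl [NeZero N] (d : Fin N → Example D) (G : Set (Vec D))
    (A : CProg D) : A.outputProb d G + A.outputProb d Gᶜ = 1 := by
  induction A with
  | output w => by_cases h : w ∈ G <;> simp [outputProb, h]
  | toss n p next ih =>
    simp only [outputProb, ← Finset.sum_add_distrib, ← mul_add, ih, mul_one, p.2.2]
  | query w next ih =>
    simp only [outputProb, ← add_div, ← Finset.sum_add_distrib, ih]
    exact sum_div_card 1

theorem CProg.outputProb_le_one [NeZero N] (d : Fin N → Example D) (G : Set (Vec D))
    (A : CProg D) : A.outputProb d G ≤ 1 := by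
  have h1 := A.outputProb_add_compl d G
  have h2 := A.outputProb_nonneg d Gᶜ
  linarith

theorem CProg.expectedQueries_nonneg (d : Fin N → Example D) (A : CProg D) :
    0 ≤ A.expectedQueries d := by
  induction A with
  | output w => exact le_rfl
  | toss n p next ih => exact Finset.sum_nonneg fun i _ => mul_nonneg (p.2.1 i) (ih i)
  | query w next ih =>
    exact add_nonneg zero_le_one
      (div_nonneg (Finset.sum_nonneg fun i _ => ih _ _) (Nat.cast_nonneg _))

/-- A change of the training set at one address is noticed with probability at most
(expected number of samples) `/ N`. -/
theorem CProg.outputProb_sub_le [NeZero N] {d d' : Fin N → Example D} {j : Fin N}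
    (h : ∀ i, i ≠ j → d i = d' i) (G : Set (Vec D)) (A : CProg D) :
    A.outputProb d' G - A.outputProb d G ≤ A.expectedQueries d / N := by
  have hN : (0 : ℝ) < N := Nat.cast_pos.mpr (NeZero.pos N)
  induction A with
  | output w => simp [outputProb, expectedQueries]
  | toss n p next ih =>
    simp only [outputProb, expectedQueries, ← Finset.sum_sub_distrib, Finset.sum_div, ← mul_sub,
      mul_div_assoc]
    exact Finset.sum_le_sum fun i _ => mul_le_mul_of_nonneg_left (ih i) (p.2.1 i)
  | query w next ih =>
    simp only [outputProb, expectedQueries, ← sub_div, ← Finset.sum_sub_distrib]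
    refine div_le_div_of_nonneg_right ?_ hN.le
    classical
    -- Coupling of the two runs by the sampled address: drawing `j` costs at most `1`, any other
    -- draw gives identical answers.
    have h1 : ∀ i, (next (d' i) (decide (Misclassifies w (d' i)))).outputProb d' G -
        (next (d i) (decide (Misclassifies w (d i)))).outputProb d G ≤
        (if i = j then 1 else 0) +
          (next (d i) (decide (Misclassifies w (d i)))).expectedQueries d / N := by
      intro i
      by_cases hi : i = j
      · rw [if_pos hi]
        have n1 := outputProb_le_one d' G (next (d' i) (decide (Misclassifies w (d' i))))
        have n2 := outputProb_nonneg d G (next (d i) (decide (Misclassifies w (d i))))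
        have n3 := div_nonneg (expectedQueries_nonneg d
          (next (d i) (decide (Misclassifies w (d i))))) hN.le
        linarith
      · rw [if_neg hi, h i hi, zero_add]
        exact ih _ _
    have h2 := Finset.sum_le_sum fun i (_ : i ∈ Finset.univ) => h1 i
    rw [Finset.sum_add_distrib] at h2
    rw [Finset.sum_div]
    simpa using h2

end Classical

/-! ### The hard training sets -/

section Hard

variable {N D : ℕ}

/-- The training set all of whose members are `(e₀, 1)`. -/
def constSet (N : ℕ) {D : ℕ} (hD : 2 ≤ D) : Fin N → Example D :=
  fun _ => (EuclideanSpace.single ⟨0, by omega⟩ 1, 1)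

/-- `constSet` with the `j`-th member replaced by `(e₁, y)`. -/
def flaggedSet (N : ℕ) {D : ℕ} (hD : 2 ≤ D) (y : ℤˣ) (j : Fin N) : Fin N → Example D :=
  Function.update (constSet N hD) j (EuclideanSpace.single ⟨1, by omega⟩ 1, y)

theorem constSet_eq_flaggedSet (hD : 2 ≤ D) (y : ℤˣ) (j i : Fin N) (h : i ≠ j) :
    constSet N hD i = flaggedSet N hD y j i :=
  (Function.update_of_ne h _ _).symm

theorem unitWithMargin_constSet (hD : 2 ≤ D) {γ : ℝ} (hγ : γ ≤ 1 / √2) :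
    UnitWithMargin γ (constSet N hD) := by
  have h1 : 1 / √2 ≤ (1 : ℝ) := by
    rw [div_le_one (by positivity)]
    exact Real.one_le_sqrt.2 one_le_two
  refine ⟨fun i => by simp [constSet], EuclideanSpace.single ⟨0, by omega⟩ 1, by simp, fun i => ?_⟩
  simpa [constSet, label] using hγ.trans h1

theorem unitWithMargin_flaggedSet (hD : 2 ≤ D) {γ : ℝ} (hγ : γ ≤ 1 / √2) (y : ℤˣ) (j : Fin N) :
    UnitWithMargin γ (flaggedSet N hD y j) := by
  have h2 : √2 * √2 = (2 : ℝ) := Real.mul_self_sqrt zero_le_two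
  have h3 : (1 / √2) * (1 / √2) = (1 / 2 : ℝ) := by
    rw [div_mul_div_comm, h2, one_mul]
  have hy : ((y : ℤ) : ℝ) * ((y : ℤ) : ℝ) = 1 := by
    rcases Int.units_eq_one_or y with rfl | rfl <;> simp
  -- The bisector of `e₀` and `y e₁` has margin exactly `1 / √2` on both kinds of members, whence
  -- the restriction on `γ`.
  let u : Vec D := (1 / √2) • (EuclideanSpace.single ⟨0, by omega⟩ 1 +
    ((y : ℤ) : ℝ) • EuclideanSpace.single ⟨1, by omega⟩ 1)
  refine ⟨fun i => ?_, u, ?_, fun i => ?_⟩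
  · by_cases hi : i = j
    · subst hi; simp [flaggedSet]
    · simp [flaggedSet, Function.update_of_ne hi, constSet]
  · have : ‖u‖ ^ 2 = 1 := by
      rw [← real_inner_self_eq_norm_sq]
      simp only [u, inner_smul_left, inner_smul_right, inner_add_left, inner_add_right,
        EuclideanSpace.inner_single_left, PiLp.single_apply]
      simp
      rw [one_div] at h3
      linear_combination 2 * h3 + (√2)⁻¹ * (√2)⁻¹ * hy
    exact (pow_eq_one_iff_of_nonneg (norm_nonneg _) two_ne_zero).1 this
  · by_cases hi : i = j
    · subst hi
      refine hγ.trans (le_of_eq ?_)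
      simp [flaggedSet, label, u, EuclideanSpace.inner_single_right]
      linear_combination (-(√2)⁻¹) * hy
    · simpa [flaggedSet, Function.update_of_ne hi, constSet, label, u,
        EuclideanSpace.inner_single_right] using hγ

theorem pos_of_notMem_badWeights_flaggedSet (hD : 2 ≤ D) (y : ℤˣ) (j : Fin N) {w : Vec D}
    (hw : w ∉ badWeights (flaggedSet N hD y j)) : 0 < ((y : ℤ) : ℝ) * w ⟨1, by omega⟩ := by
  by_contra! h
  exact hw ⟨j, by
    simpa [Misclassifies, flaggedSet, label, EuclideanSpace.inner_single_right] using h⟩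

/-- For one of two complementary events of probability at most `1 / 2` on `constSet`, failure on
all the sets `flaggedSet` with a suitable label is unavoidable outside the event. -/
theorem exists_event (hD : 2 ≤ D) (P : Set (Vec D) → ℝ) (hP : ∀ G, P G + P Gᶜ = 1) :
    ∃ (G : Set (Vec D)) (y : ℤˣ), P G ≤ 1 / 2 ∧
      ∀ j : Fin N, Gᶜ ⊆ badWeights (flaggedSet N hD y j) := by
  let G : Set (Vec D) := {w | 0 < w ⟨1, by omega⟩}
  by_cases h : P G ≤ 1 / 2
  · refine ⟨G, 1, h, fun j w hw => ?_⟩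
    by_contra hb
    exact hw (by simpa [G] using pos_of_notMem_badWeights_flaggedSet hD 1 j hb)
  · refine ⟨Gᶜ, -1, by linarith [hP G], fun j w hw => ?_⟩
    by_contra hb
    have := pos_of_notMem_badWeights_flaggedSet hD (-1) j hb
    rw [compl_compl] at hw
    simp only [G, Set.mem_ofPred_eq] at hw
    simp at this
    linarith

/-! ### The two lower bounds -/

theorem quantum_lower_bound (ε₀ : ℝ) (hε₀ : ε₀ < 1 / 2) : ∃ κ : ℝ, 0 < κ ∧
    ∀ (N D : ℕ), 1 ≤ N → 2 ≤ D → ∀ γ ε : ℝ, 0 < γ → γ ≤ 1 / √2 → 0 < ε → ε ≤ ε₀ →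
      ∀ (W : Type) [Fintype W] (A : QProg N D W) (ψ : State N W), ‖ψ‖ = 1 →
        (∀ d : Fin N → Example D, UnitWithMargin γ d → A.outputProb d (badWeights d) ψ ≤ ε) →
        ∃ d : Fin N → Example D, UnitWithMargin γ d ∧ κ * √(N : ℝ) ≤ A.expectedQueries d ψ := by
  refine ⟨(1 / 2 - ε₀) ^ 2 / 4, by have : 0 < 1 / 2 - ε₀ := by linarith
                                   positivity, ?_⟩
  intro N D hN hD γ ε hγ hγ1 hε hε1 W _ A ψ hψ hA
  obtain ⟨G, y, hG, hb⟩ := exists_event (N := N) hD (fun G => A.outputProb (constSet N hD) G ψ)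
    fun G => by rw [QProg.outputProb_add_compl, hψ, one_pow]
  -- Outside `G` the output fails on every flagged set, which has probability at most `ε₀ = 1/2 -
  -- δ`.
  rcases QProg.exists_expectedQueries_ge hN (constSet_eq_flaggedSet hD y) G
    (δ := 1 / 2 - ε₀) (by linarith) (by linarith) A ψ hψ hG (fun j => by
      have h1 := QProg.outputProb_mono (flaggedSet N hD y j) (hb j) A ψ
      have h2 := hA _ (unitWithMargin_flaggedSet hD hγ1 y j)
      linarith) with h | ⟨j, h⟩
  · exact ⟨_, unitWithMargin_constSet hD hγ1, h⟩
  · exact ⟨_, unitWithMargin_flaggedSet hD hγ1 y j, h⟩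

theorem classical_lower_bound (ε₀ : ℝ) (hε₀ : ε₀ < 1 / 2) : ∃ κ : ℝ, 0 < κ ∧
    ∀ (N D : ℕ), 1 ≤ N → 2 ≤ D → ∀ γ ε : ℝ, 0 < γ → γ ≤ 1 / √2 → 0 < ε → ε ≤ ε₀ →
      ∀ A : CProg D,
        (∀ d : Fin N → Example D, UnitWithMargin γ d → A.outputProb d (badWeights d) ≤ ε) →
        ∃ d : Fin N → Example D, UnitWithMargin γ d ∧ κ * (N : ℝ) ≤ A.expectedQueries d := by
  refine ⟨1 / 2 - ε₀, by linarith, ?_⟩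
  intro N D hN hD γ ε hγ hγ1 hε hε1 A hA
  have : NeZero N := ⟨by omega⟩
  refine ⟨constSet N hD, unitWithMargin_constSet hD hγ1, ?_⟩
  obtain ⟨G, y, hG, hb⟩ := exists_event (N := N) hD (fun G => A.outputProb (constSet N hD) G)
    fun G => CProg.outputProb_add_compl _ G A
  -- A single changed address suffices, as uniform sampling treats all addresses alike.
  let j : Fin N := 0
  have h1 := CProg.outputProb_mono (flaggedSet N hD y j) (hb j) A
  have h2 := hA _ (unitWithMargin_flaggedSet hD hγ1 y j)
  have h3 := CProg.outputProb_add_compl (flaggedSet N hD y j) G A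
  have h4 := CProg.outputProb_sub_le (constSet_eq_flaggedSet hD y j) G A
  rw [← le_div_iff₀ (by exact_mod_cast hN)]
  linarith

end Hard

/-! ### Convergence of the perceptron -/

section Perceptron

variable {N D : ℕ}

theorem label_mul_self (x : Example D) : label x * label x = 1 := by
  unfold label
  rcases Int.units_eq_one_or x.2 with h | h <;> simp [h]

/-- The weights `w` are compatible with `k` perceptron updates on vectors with margin `γ` with
respect to `u`. -/
def UpdateBound (u : Vec D) (γ : ℝ) (k : ℕ) (w : Vec D) : Prop :=
  k * γ ≤ inner ℝ u w ∧ ‖w‖ ^ 2 ≤ k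

theorem updateBound_zero (u : Vec D) (γ : ℝ) : UpdateBound u γ 0 0 := by
  simp [UpdateBound]

/-- In `‖w + y φ‖² = ‖w‖² + 2 y ⟪w, φ⟫ + 1` the cross term is nonpositive because `w` misclassifies
the vector. -/
theorem UpdateBound.update {u w : Vec D} {γ : ℝ} {k : ℕ} (h : UpdateBound u γ k w)
    {x : Example D} (hx : ‖x.1‖ = 1) (hu : γ ≤ label x * inner ℝ u x.1)
    (hw : Misclassifies w x) : UpdateBound u γ (k + 1) (update w x) := by
  obtain ⟨h1, h2⟩ := h
  unfold Misclassifies at hw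
  unfold QuantumPerceptron.update
  constructor
  · rw [inner_add_right, inner_smul_right]
    push_cast
    linarith
  · have h3 := label_mul_self x
    rw [norm_add_sq_real, inner_smul_right, norm_smul, hx, mul_one, Real.norm_eq_abs, sq_abs]
    push_cast
    nlinarith

/-- Cauchy-Schwarz gives `k γ ≤ ‖w‖ ≤ √k`, hence `k ≤ 1 / γ²`. -/
theorem UpdateBound.le_floor {u w : Vec D} {γ : ℝ} {k : ℕ} (h : UpdateBound u γ k w)
    (hu : ‖u‖ = 1) (hγ : 0 < γ) : k ≤ ⌊1 / γ ^ 2⌋₊ := by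
  obtain ⟨h1, h2⟩ := h
  refine Nat.le_floor ?_
  rcases Nat.eq_zero_or_pos k with rfl | hk
  · simp only [Nat.cast_zero]; positivity
  have hk' : (0 : ℝ) < k := by exact_mod_cast hk
  have h3 : k * γ ≤ ‖w‖ := by
    have := real_inner_le_norm u w
    rw [hu, one_mul] at this
    exact h1.trans this
  have h4 : (k * γ) ^ 2 ≤ k := (pow_le_pow_left₀ (by positivity) h3 2).trans h2
  rw [le_div_iff₀ (by positivity)]
  refine le_of_mul_le_mul_left ?_ hk'
  linarith

/-- A misclassified vector would permit one more update than `UpdateBound.le_floor` allows. So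
exhausting the rounds is harmless. -/
theorem UpdateBound.notMem_badWeights {d : Fin N → Example D} {u w : Vec D} {γ : ℝ}
    (hd : ∀ i, ‖(d i).1‖ = 1) (hu : ‖u‖ = 1) (hγ : 0 < γ)
    (hm : ∀ i, γ ≤ label (d i) * inner ℝ u (d i).1)
    (h : UpdateBound u γ ⌊1 / γ ^ 2⌋₊ w) : w ∉ badWeights d := by
  rintro ⟨j, hj⟩
  have := (h.update (hd j) (hm j) hj).le_floor hu hγ
  omega

end Perceptron

/-! ### Grover search -/

section Grover

variable {N D : ℕ}

/-- One Grover iteration `(2 Ψ Ψ† - 1) F_w`. -/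
def groverStep (d : Fin N → Example D) (w : Vec D) (ψ : State N Unit) : State N Unit :=
  reflectUniform N (oracleF d (fun _ => w) ψ)

theorem norm_groverStep (d : Fin N → Example D) (w : Vec D) (ψ : State N Unit) :
    ‖groverStep d w ψ‖ = ‖ψ‖ := by
  rw [groverStep, LinearIsometryEquiv.norm_map, norm_oracleF]

theorem norm_iterate_groverStep (d : Fin N → Example D) (w : Vec D) (m : ℕ) (ψ : State N Unit) :
    ‖(groverStep d w)^[m] ψ‖ = ‖ψ‖ := by
  induction m generalizing ψ with
  | zero => rfl
  | succ m ih => rw [Function.iterate_succ_apply, ih, norm_groverStep]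

theorem outputProb_groverSteps (d : Fin N → Example D) (G : Set (Vec D)) (w : Vec D) (m : ℕ)
    (next : QProg N D Unit) (ψ : State N Unit) :
    (groverSteps w m next).outputProb d G ψ = next.outputProb d G ((groverStep d w)^[m] ψ) := by
  induction m generalizing ψ with
  | zero => rfl
  | succ m ih =>
    rw [Function.iterate_succ_apply]
    exact ih _

theorem maxQueries_groverSteps (d : Fin N → Example D) (w : Vec D) (m : ℕ)
    (next : QProg N D Unit) :
    (groverSteps w m next).maxQueries d = m + next.maxQueries d := by
  induction m with
  | zero => simp [groverSteps]
  | succ m ih => simp only [groverSteps, QProg.maxQueries, ih]; omega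

open Classical in
/-- The state with amplitude `a` on the misclassified addresses and `b` on the others. -/
def twoLevel (d : Fin N → Example D) (w : Vec D) (a b : ℝ) : State N Unit :=
  WithLp.toLp 2 fun x => ((if Misclassifies w (d x.1) then a else b : ℝ) : ℂ)

open Classical in
/-- The number of misclassified addresses. -/
def missCount (d : Fin N → Example D) (w : Vec D) : ℕ :=
  (Finset.univ.filter fun i => Misclassifies w (d i)).card

open Classical in
theorem sum_ite_misclassifies (d : Fin N → Example D) (w : Vec D) (a b : ℝ) :
    ∑ i, (if Misclassifies w (d i) then a else b) =
      missCount d w * a + (N - missCount d w) * b := by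
  have h : ((Finset.univ.filter fun i => ¬ Misclassifies w (d i)).card : ℝ) =
      N - missCount d w := by
    have := Finset.card_filter_add_card_filter_not (s := Finset.univ)
      (fun i => Misclassifies w (d i))
    rw [Finset.card_univ, Fintype.card_fin] at this
    rw [missCount, eq_sub_iff_add_eq']
    exact_mod_cast this
  rw [Finset.sum_ite, Finset.sum_const, Finset.sum_const, nsmul_eq_mul, nsmul_eq_mul, h, missCount]

/-- The reflection `2ΨΨ† - 1` is inversion about the mean amplitude, and `F_w` has first changed `a`
to `-a`. Two-level states are therefore preserved. -/
theorem groverStep_twoLevel [NeZero N] (d : Fin N → Example D) (w : Vec D) (a b : ℝ) :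
    groverStep d w (twoLevel d w a b) =
      twoLevel d w
        (2 * ((-(missCount d w * a) + (N - missCount d w) * b) / N) + a)
        (2 * ((-(missCount d w * a) + (N - missCount d w) * b) / N) - b) := by
  classical
  have h1 : oracleF d (fun _ => w) (twoLevel d w a b) = twoLevel d w (-a) b := by
    ext x
    simp only [oracleF, twoLevel]
    split_ifs <;> simp
  have h0 : (0 : ℝ) ≤ N := Nat.cast_nonneg N
  have hN : (√(N : ℝ))⁻¹ * (√(N : ℝ))⁻¹ = (N : ℝ)⁻¹ := by
    rw [← mul_inv, Real.mul_self_sqrt h0]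
  have h2 : inner ℂ (uniformState N) (twoLevel d w (-a) b) =
      (((√(N : ℝ))⁻¹ * (-(missCount d w * a) + (N - missCount d w) * b) : ℝ) : ℂ) := by
    have h3 := sum_ite_misclassifies d w (-a) b
    rw [mul_neg] at h3
    rw [← h3, Complex.ofReal_mul, Complex.ofReal_sum, Finset.mul_sum]
    simp only [PiLp.inner_apply, uniformState, twoLevel, Fintype.sum_prod_type]
    simp [mul_comm]
  rw [groverStep, h1, reflectUniform, Submodule.reflection_singleton_apply, h2,
    norm_uniformState]
  ext x
  have h4 : ∀ s y : ℝ, 2 * ((√(N : ℝ))⁻¹ * s * (√(N : ℝ))⁻¹) - y = 2 * (s / N) - y := by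
    intro s y
    linear_combination (2 * s) * hN
  have h5 := h4 (-(missCount d w * a) + (N - missCount d w) * b)
    (if Misclassifies w (d x.1) then -a else b)
  have h6 := congrArg (fun r : ℝ => (r : ℂ)) h5
  simp only [twoLevel, uniformState]
  by_cases hx : Misclassifies w (d x.1)
  · simp [hx] at h6 ⊢
    rw [← h6]
  · simp [hx] at h6 ⊢
    rw [← h6]

theorem uniformState_eq_twoLevel (d : Fin N → Example D) (w : Vec D) :
    uniformState N = twoLevel d w (√(N : ℝ))⁻¹ (√(N : ℝ))⁻¹ := by
  ext x
  simp [uniformState, twoLevel]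

/-- In the plane of two-level states an iteration is the rotation by `2θ`, and the initial angle is
`θ`. Both divisors must be nonzero, which excludes the cases of no and of only misclassified
vectors. -/
theorem iterate_groverStep_uniformState [NeZero N] (d : Fin N → Example D) (w : Vec D) {θ : ℝ}
    (hs : Real.sin θ ≠ 0) (hc : Real.cos θ ≠ 0)
    (hθ : N * Real.sin θ ^ 2 = missCount d w) (m : ℕ) :
    (groverStep d w)^[m] (uniformState N) =
      twoLevel d w (Real.sin ((2 * m + 1) * θ) / (√(N : ℝ) * Real.sin θ))
        (Real.cos ((2 * m + 1) * θ) / (√(N : ℝ) * Real.cos θ)) := by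
  have hN : (0 : ℝ) < N := Nat.cast_pos.mpr (NeZero.pos N)
  have hS : √(N : ℝ) ≠ 0 := (Real.sqrt_pos.2 hN).ne'
  have hSS : √(N : ℝ) ^ 2 = N := Real.sq_sqrt hN.le
  induction m with
  | zero =>
    rw [Function.iterate_zero_apply, uniformState_eq_twoLevel d w]
    congr 1 <;> · simp; field_simp
  | succ m ih =>
    rw [Function.iterate_succ_apply', ih, groverStep_twoLevel, ← hθ]
    have hcos : (N : ℝ) - N * Real.sin θ ^ 2 = N * Real.cos θ ^ 2 := by
      rw [Real.cos_sq']; ring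
    rw [hcos]
    set x := (2 * (m : ℝ) + 1) * θ with hx
    have hx2 : (2 * ((m + 1 : ℕ) : ℝ) + 1) * θ = x + 2 * θ := by rw [hx]; push_cast; ring
    -- The mean amplitude after `F_w` is `cos (x + θ) / √N`; the addition formulas then advance `x`
    -- by `2θ`.
    have hμ : (-(N * Real.sin θ ^ 2 * (Real.sin x / (√(N : ℝ) * Real.sin θ))) +
        N * Real.cos θ ^ 2 * (Real.cos x / (√(N : ℝ) * Real.cos θ))) / N =
        Real.cos (x + θ) / √(N : ℝ) := by
      rw [Real.cos_add]
      field_simp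
      ring
    rw [hμ, hx2]
    have e1 : Real.sin (x + 2 * θ) = 2 * Real.cos (x + θ) * Real.sin θ + Real.sin x := by
      rw [Real.sin_add, Real.cos_add, Real.sin_two_mul, Real.cos_two_mul]
      linear_combination (2 * Real.sin x) * Real.sin_sq_add_cos_sq θ
    have e2 : Real.cos (x + 2 * θ) = 2 * Real.cos (x + θ) * Real.cos θ - Real.cos x := by
      rw [Real.cos_add, Real.cos_add, Real.sin_two_mul, Real.cos_two_mul]
      ring
    rw [e1, e2]
    congr 1 <;> field_simp

open Classical in
/-- The weight of the state on the correctly classified addresses. -/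
def missWeight (d : Fin N → Example D) (w : Vec D) (ψ : State N Unit) : ℝ :=
  ∑ q, if Misclassifies w (d q) then 0 else ‖project Prod.fst q ψ‖ ^ 2

theorem missWeight_nonneg (d : Fin N → Example D) (w : Vec D) (ψ : State N Unit) :
    0 ≤ missWeight d w ψ :=
  Finset.sum_nonneg fun q _ => by split_ifs <;> positivity

theorem missWeight_le (d : Fin N → Example D) (w : Vec D) (ψ : State N Unit) :
    missWeight d w ψ ≤ ‖ψ‖ ^ 2 := by
  rw [← sum_norm_sq_project Prod.fst ψ]
  exact Finset.sum_le_sum fun q _ => by split_ifs <;> simp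

theorem missWeight_twoLevel (d : Fin N → Example D) (w : Vec D) (a b : ℝ) :
    missWeight d w (twoLevel d w a b) = (N - missCount d w) * b ^ 2 := by
  classical
  have h := sum_ite_misclassifies d w 0 (b ^ 2)
  rw [mul_zero, zero_add] at h
  rw [← h, missWeight]
  refine Finset.sum_congr rfl fun q _ => ?_
  by_cases hq : Misclassifies w (d q)
  · simp [hq]
  · rw [if_neg hq, if_neg hq, norm_sq_eq_sum, Fintype.sum_prod_type, Finset.sum_eq_single q]
    · simp [project, twoLevel, hq]
    · intro i _ hi; simp [project, hi]
    · simp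

/-- The probability that a search attempt with parameter `M` finds no misclassified vector. -/
def missProb (d : Fin N → Example D) (w : Vec D) (M : ℕ) : ℝ :=
  (∑ m : Fin (M + 1), missWeight d w ((groverStep d w)^[m] (uniformState N))) / (M + 1 : ℕ)

theorem missProb_nonneg (d : Fin N → Example D) (w : Vec D) (M : ℕ) : 0 ≤ missProb d w M :=
  div_nonneg (Finset.sum_nonneg fun _ _ => missWeight_nonneg _ _ _) (Nat.cast_nonneg _)

theorem missProb_le_one [NeZero N] (d : Fin N → Example D) (w : Vec D) (M : ℕ) :
    missProb d w M ≤ 1 := by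
  rw [missProb, div_le_one (by positivity)]
  calc _ ≤ ∑ _m : Fin (M + 1), (1 : ℝ) := Finset.sum_le_sum fun m _ => by
        refine (missWeight_le _ _ _).trans ?_
        rw [norm_iterate_groverStep, norm_uniformState, one_pow]
    _ = _ := by simp

/-- Telescoping sum, stated without denominators: the mean of the squared cosines is `1/2 + sin
(4nθ) / (4n sin 2θ)`. -/
theorem sum_cos_sq (θ : ℝ) (n : ℕ) :
    (∑ m ∈ Finset.range n, Real.cos ((2 * m + 1) * θ) ^ 2) * (4 * Real.sin (2 * θ)) =
      2 * n * Real.sin (2 * θ) + Real.sin (4 * n * θ) := by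
  induction n with
  | zero => simp
  | succ n ih =>
    rw [Finset.sum_range_succ, add_mul, ih]
    set x := (2 * (n : ℝ) + 1) * θ with hx
    have h1 : 4 * (n : ℝ) * θ = 2 * x - 2 * θ := by rw [hx]; ring
    have h2 : 4 * ((n + 1 : ℕ) : ℝ) * θ = 2 * x + 2 * θ := by rw [hx]; push_cast; ring
    rw [h1, h2, Real.sin_sub, Real.sin_add, Real.cos_two_mul x]
    push_cast
    ring

/-- If some vector is misclassified, an attempt with a sufficiently large parameter finds one with
probability at least `1 / 4`. -/
theorem missProb_le_of_misclassifies [NeZero N] (d : Fin N → Example D) (w : Vec D) (M : ℕ)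
    (hM : 2 ≤ N → (N : ℝ) ≤ (M + 1) * (2 * √((N : ℝ) - 1))) (hw : w ∈ badWeights d) :
    missProb d w M ≤ 3 / 4 := by
  classical
  obtain ⟨j, hj⟩ := hw
  have hN : (0 : ℝ) < N := Nat.cast_pos.mpr (NeZero.pos N)
  have ht : 1 ≤ missCount d w :=
    Finset.card_pos.2 ⟨j, Finset.mem_filter.2 ⟨Finset.mem_univ _, hj⟩⟩
  have htN : missCount d w ≤ N := (Finset.card_filter_le _ _).trans (by simp)
  -- If all vectors are misclassified then `cos θ = 0` and the rotation formula is unavailable, but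
  -- every outcome is a success. This also covers `N = 1`.
  rcases htN.eq_or_lt with h | hlt
  · have hall : ∀ i, Misclassifies w (d i) := by
      have := (Finset.card_filter_eq_iff (s := Finset.univ)
        (p := fun i => Misclassifies w (d i))).1 (by simpa [missCount] using h)
      exact fun i => this i (Finset.mem_univ _)
    simp only [missProb, missWeight, hall, if_true, Finset.sum_const_zero, zero_div]
    norm_num
  have ht' : (1 : ℝ) ≤ missCount d w := by exact_mod_cast ht
  have hlt' : (missCount d w : ℝ) + 1 ≤ N := by exact_mod_cast hlt
  set t : ℝ := (missCount d w : ℝ) with htdef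
  set θ := Real.arcsin √(t / N) with hθ
  have htN0 : 0 < t / N := by positivity
  have htN1 : t / N < 1 := (div_lt_one hN).2 (by linarith)
  have hsin : Real.sin θ = √(t / N) :=
    Real.sin_arcsin (by linarith [Real.sqrt_nonneg (t / N)]) (Real.sqrt_le_one.2 htN1.le)
  have hcos : Real.cos θ = √(1 - t / N) := by
    rw [hθ, Real.cos_arcsin, Real.sq_sqrt htN0.le]
  have hs : 0 < Real.sin θ := by rw [hsin]; exact Real.sqrt_pos.2 htN0
  have hc : 0 < Real.cos θ := by rw [hcos]; exact Real.sqrt_pos.2 (by linarith)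
  have hθ1 : N * Real.sin θ ^ 2 = t := by
    rw [hsin, Real.sq_sqrt htN0.le]; field_simp
  have hθ2 : (N : ℝ) - t = N * Real.cos θ ^ 2 := by
    rw [Real.cos_sq', mul_sub, mul_one, hθ1]
  have hwt : ∀ m : ℕ, missWeight d w ((groverStep d w)^[m] (uniformState N)) =
      Real.cos ((2 * m + 1) * θ) ^ 2 := by
    intro m
    rw [iterate_groverStep_uniformState d w hs.ne' hc.ne' hθ1, missWeight_twoLevel, ← htdef, hθ2,
      div_pow, mul_pow, Real.sq_sqrt hN.le]
    field_simp
  have h2θ : 0 < Real.sin (2 * θ) := by rw [Real.sin_two_mul]; positivity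
  -- Here `N sin θ cos θ = √(t (N - t))`, and `t (N - t) ≥ N - 1` for `1 ≤ t ≤ N - 1`: a single
  -- misclassified vector is the worst case.
  have hbig : 1 ≤ ((M + 1 : ℕ) : ℝ) * Real.sin (2 * θ) := by
    have h1 := hM (by omega)
    have h2 : √((N : ℝ) - 1) ≤ N * (Real.sin θ * Real.cos θ) := by
      refine Real.sqrt_le_iff.2 ⟨by positivity, ?_⟩
      have : (N * (Real.sin θ * Real.cos θ)) ^ 2 = t * (N - t) := by
        rw [hθ2]; linear_combination (N * Real.cos θ ^ 2) * hθ1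
      rw [this]
      nlinarith
    have h3 : (N : ℝ) ≤ N * (((M + 1 : ℕ) : ℝ) * Real.sin (2 * θ)) := by
      refine h1.trans ?_
      have h4 : (0 : ℝ) ≤ (M + 1) * 2 := by positivity
      have h5 := mul_le_mul_of_nonneg_left h2 h4
      rw [Real.sin_two_mul]
      push_cast
      linarith
    exact le_of_mul_le_mul_left (by linarith) hN
  rw [missProb, div_le_iff₀ (by positivity)]
  simp only [hwt]
  rw [Fin.sum_univ_eq_sum_range (fun m : ℕ => Real.cos ((2 * m + 1) * θ) ^ 2)]
  have h6 := sum_cos_sq θ (M + 1)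
  have h7 := Real.sin_le_one (4 * ((M + 1 : ℕ) : ℝ) * θ)
  refine le_of_mul_le_mul_right ?_ (mul_pos four_pos h2θ)
  rw [h6]
  linarith

/-- For `N = 1` both sides are divisions by zero, with value `0`. -/
theorem one_div_sin_two_mul_arcsin (hN : 1 ≤ N) :
    1 / Real.sin (2 * Real.arcsin (1 / √(N : ℝ))) = N / (2 * √((N : ℝ) - 1)) := by
  have h1 : (1 : ℝ) ≤ N := by exact_mod_cast hN
  have h0 : (0 : ℝ) < N := by linarith
  have hS : 1 ≤ √(N : ℝ) := Real.one_le_sqrt.2 h1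
  have hS0 : 0 < √(N : ℝ) := by linarith
  have hle : 1 / √(N : ℝ) ≤ 1 := (div_le_one hS0).2 hS
  have hpos : 0 < 1 / √(N : ℝ) := by positivity
  have h2 : 1 - (1 / √(N : ℝ)) ^ 2 = (N - 1) / N := by
    rw [div_pow, Real.sq_sqrt h0.le]
    field_simp
  rw [Real.sin_two_mul, Real.sin_arcsin (by linarith) hle, Real.cos_arcsin, h2,
    Real.sqrt_div (by linarith)]
  have h3 : 2 * (1 / √(N : ℝ)) * (√((N : ℝ) - 1) / √(N : ℝ)) = 2 * √((N : ℝ) - 1) / N := by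
    rw [mul_one_div, div_mul_div_comm, Real.mul_self_sqrt h0.le]
  rw [h3, one_div_div]

theorem le_of_innerLength {c : ℝ} (hc : 1 < c) (hN : 2 ≤ N) :
    (N : ℝ) ≤ (⌈c ^ innerLength N c⌉₊ + 1) * (2 * √((N : ℝ) - 1)) := by
  have h1 : (2 : ℝ) ≤ N := by exact_mod_cast hN
  have hS : 0 < √((N : ℝ) - 1) := Real.sqrt_pos.2 (by linarith)
  have hpos : 0 < (N : ℝ) / (2 * √((N : ℝ) - 1)) := by positivity
  rw [← div_le_iff₀ (by positivity)]
  have h2 : (N : ℝ) / (2 * √((N : ℝ) - 1)) ≤ c ^ innerLength N c := by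
    rw [← Real.rpow_natCast, ← Real.logb_le_iff_le_rpow hc hpos]
    refine (Nat.le_ceil _).trans ?_
    rw [innerLength, one_div_sin_two_mul_arcsin (by omega)]
    exact_mod_cast le_max_right _ _
  have h3 := Nat.le_ceil (c ^ innerLength N c)
  linarith

end Grover

/-! ### Failure probability of the online quantum perceptron -/

section Training

variable {N D : ℕ} [NeZero N]

/-- Here `a` bounds the failure probability after a success, and `b` is the excess incurred without
one. Since `Ψ` is prepared afresh, an attempt merely multiplies `b` by its miss probability, and the
factors of successive attempts multiply up. -/
theorem outputProb_attempt_le (d : Fin N → Example D) (G : Set (Vec D)) (w : Vec D) (M : ℕ)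
    {found : Example D → QProg N D Unit} {next : QProg N D Unit} {a b : ℝ}
    (hfound : ∀ q, Misclassifies w (d q) →
      ∀ χ, (found (d q)).outputProb d G χ ≤ a * ‖χ‖ ^ 2)
    (hnext : ∀ χ, next.outputProb d G χ ≤ (a + b) * ‖χ‖ ^ 2) (ψ : State N Unit) :
    (attempt w M found next).outputProb d G ψ ≤ (a + b * missProb d w M) * ‖ψ‖ ^ 2 := by
  classical
  have key : ∀ m : ℕ, ∑ q, (if Misclassifies w (d q) then found (d q) else next).outputProb d G
      (project Prod.fst q ((groverStep d w)^[m] (uniformState N))) ≤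
      a + b * missWeight d w ((groverStep d w)^[m] (uniformState N)) := by
    intro m
    have h1 : ‖(groverStep d w)^[m] (uniformState N)‖ ^ 2 = 1 := by
      rw [norm_iterate_groverStep, norm_uniformState, one_pow]
    set χ := (groverStep d w)^[m] (uniformState N)
    rw [← sum_norm_sq_project Prod.fst χ] at h1
    calc _ ≤ ∑ q, (a * ‖project Prod.fst q χ‖ ^ 2 +
          b * if Misclassifies w (d q) then 0 else ‖project Prod.fst q χ‖ ^ 2) := by
          refine Finset.sum_le_sum fun q _ => ?_
          by_cases hq : Misclassifies w (d q)
          · simpa [hq] using hfound q hq _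
          · have := hnext (project Prod.fst q χ)
            simp only [hq, if_false]
            linarith
      _ = _ := by
          rw [Finset.sum_add_distrib, ← Finset.mul_sum, ← Finset.mul_sum, h1, mul_one, missWeight]
  simp only [attempt, QProg.outputProb, outputProb_groverSteps, stdSimplex.barycenter_apply,
    Fintype.card_fin]
  calc _ ≤ ∑ m : Fin (M + 1), ((M + 1 : ℕ) : ℝ)⁻¹ * (‖ψ‖ ^ 2 *
        (a + b * missWeight d w ((groverStep d w)^[m] (uniformState N)))) := by
        refine Finset.sum_le_sum fun m _ => ?_
        refine mul_le_mul_of_nonneg_left (mul_le_mul_of_nonneg_left ?_ (sq_nonneg _))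
          (by positivity)
        convert key m
    _ = _ := by
        have h0 : ((M + 1 : ℕ) : ℝ) ≠ 0 := by positivity
        rw [← Finset.mul_sum, ← Finset.mul_sum, Finset.sum_add_distrib, ← Finset.mul_sum,
          missProb]
        simp only [Finset.sum_const, Finset.card_univ, Fintype.card_fin, nsmul_eq_mul]
        field_simp

theorem outputProb_attempts_le (d : Fin N → Example D) (G : Set (Vec D)) (w : Vec D)
    {found : Example D → QProg N D Unit} {notFound : QProg N D Unit} {a b : ℝ}
    (hfound : ∀ q, Misclassifies w (d q) →
      ∀ χ, (found (d q)).outputProb d G χ ≤ a * ‖χ‖ ^ 2)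
    (hnot : ∀ χ, notFound.outputProb d G χ ≤ (a + b) * ‖χ‖ ^ 2) (Ms : List ℕ)
    (ψ : State N Unit) :
    (attempts w found notFound Ms).outputProb d G ψ ≤
      (a + b * (Ms.map (missProb d w)).prod) * ‖ψ‖ ^ 2 := by
  induction Ms generalizing ψ with
  | nil => simpa [attempts] using hnot ψ
  | cons M Ms ih =>
    rw [attempts, List.map_cons, List.prod_cons]
    refine (outputProb_attempt_le d G w M hfound ih ψ).trans (le_of_eq ?_)
    ring

theorem prod_map_missProb_le_one (d : Fin N → Example D) (w : Vec D) (Ms : List ℕ) :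
    (Ms.map (missProb d w)).prod ≤ 1 := by
  induction Ms with
  | nil => simp
  | cons M Ms ih =>
    rw [List.map_cons, List.prod_cons]
    have h0 : 0 ≤ (Ms.map (missProb d w)).prod :=
      List.prod_nonneg fun x hx => by
        obtain ⟨M, -, rfl⟩ := List.mem_map.1 hx
        exact missProb_nonneg d w M
    exact mul_le_one₀ (missProb_le_one d w M) h0 ih

theorem prod_map_missProb_schedule_le (d : Fin N → Example D) (w : Vec D) {c γ ε : ℝ} (hc : 1 < c)
    (hγ : 0 < γ) (hε : 0 < ε) (hw : w ∈ badWeights d) :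
    ((schedule N c γ ε).map (missProb d w)).prod ≤ γ ^ 2 * ε := by
  set block := (List.range' 1 (innerLength N c)).map fun j => ⌈c ^ j⌉₊ with hblock
  have h0 : 0 ≤ (block.map (missProb d w)).prod :=
    List.prod_nonneg fun x hx => by
      obtain ⟨M, -, rfl⟩ := List.mem_map.1 hx
      exact missProb_nonneg d w M
  -- Only the last and largest parameter of a block is known to succeed with probability `1/4`; the
  -- other factors are bounded by `1`.
  have h1 : (block.map (missProb d w)).prod ≤ 3 / 4 := by
    have hM := missProb_le_of_misclassifies d w ⌈c ^ innerLength N c⌉₊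
      (fun h => le_of_innerLength hc h) hw
    obtain ⟨l, hl⟩ : ∃ l, innerLength N c = l + 1 :=
      Nat.exists_eq_succ_of_ne_zero (Nat.one_le_iff_ne_zero.1 (le_max_left _ _))
    rw [hblock, hl, List.range'_concat, List.map_append, List.map_append, List.prod_append]
    rw [hl] at hM
    have h2 := prod_map_missProb_le_one d w ((List.range' 1 l).map fun j => ⌈c ^ j⌉₊)
    have h3 := missProb_nonneg d w ⌈c ^ (l + 1)⌉₊
    simp only [List.map_cons, List.map_nil, List.prod_cons, List.prod_nil, mul_one, one_mul]
    rw [add_comm 1 l]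
    nlinarith
  have h2 : ((schedule N c γ ε).map (missProb d w)).prod =
      (block.map (missProb d w)).prod ^ ⌈Real.logb (3 / 4) (γ ^ 2 * ε)⌉₊ := by
    rw [schedule, ← hblock, List.map_flatten, List.prod_flatten, List.map_replicate,
      List.map_replicate, List.prod_replicate]
  have hpos : 0 < γ ^ 2 * ε := by positivity
  rw [h2]
  refine (pow_le_pow_left₀ h0 h1 _).trans ?_
  rw [← Real.rpow_natCast]
  refine (Real.rpow_le_rpow_of_exponent_ge (by norm_num) (by norm_num) (Nat.le_ceil _)).trans ?_
  rw [Real.rpow_logb (by norm_num) (by norm_num) hpos]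

/-- Induction on the remaining rounds `n`, after `k` updates. Good weights are never changed and
finally output; with bad weights a round stops wrongly with probability at most `γ² ε`, and
otherwise the induction hypothesis applies to the updated weights. -/
theorem outputProb_train_le {d : Fin N → Example D} {u : Vec D} {c γ ε : ℝ} (hc : 1 < c)
    (hγ : 0 < γ) (hε : 0 < ε) (hd : ∀ i, ‖(d i).1‖ = 1) (hu : ‖u‖ = 1)
    (hm : ∀ i, γ ≤ label (d i) * inner ℝ u (d i).1) (n k : ℕ) (hnk : k + n = ⌊1 / γ ^ 2⌋₊)
    (w : Vec D) (hw : UpdateBound u γ k w) (ψ : State N Unit) :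
    (train c γ ε n w).outputProb d (badWeights d) ψ ≤ n * (γ ^ 2 * ε) * ‖ψ‖ ^ 2 := by
  induction n generalizing k w ψ with
  | zero =>
    rw [add_zero] at hnk
    rw [hnk] at hw
    simp [train, QProg.outputProb, hw.notMem_badWeights hd hu hγ hm]
  | succ n ih =>
    have hpos : 0 < γ ^ 2 * ε := by positivity
    rw [train]
    by_cases hb : w ∈ badWeights d
    · have hfound : ∀ q, Misclassifies w (d q) → ∀ χ,
          (train c γ ε n (update w (d q)) : QProg N D Unit).outputProb d (badWeights d) χ ≤
            n * (γ ^ 2 * ε) * ‖χ‖ ^ 2 := fun q hq χ =>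
        ih (k + 1) (by omega) _ (hw.update (hd q) (hm q) hq) χ
      refine (outputProb_attempts_le (b := 1) d (badWeights d) w hfound ?_ _ ψ).trans ?_
      · intro χ
        rw [QProg.outputProb, if_pos hb]
        have : 0 ≤ n * (γ ^ 2 * ε) * ‖χ‖ ^ 2 := by positivity
        linarith
      · refine mul_le_mul_of_nonneg_right ?_ (sq_nonneg _)
        have := prod_map_missProb_schedule_le d w hc hγ hε hb
        push_cast
        linarith
    · refine (outputProb_attempts_le (a := 0) (b := 0) d (badWeights d) w
        (fun q hq => absurd ⟨q, hq⟩ hb) ?_ _ ψ).trans ?_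
      · intro χ
        simp [QProg.outputProb, hb]
      · rw [zero_mul, add_zero, zero_mul]
        positivity

theorem floor_mul_le {γ ε : ℝ} (hγ : 0 < γ) (hε : 0 < ε) :
    (⌊1 / γ ^ 2⌋₊ : ℝ) * (γ ^ 2 * ε) ≤ ε := by
  have h1 : (⌊1 / γ ^ 2⌋₊ : ℝ) ≤ 1 / γ ^ 2 := Nat.floor_le (by positivity)
  calc _ ≤ 1 / γ ^ 2 * (γ ^ 2 * ε) := mul_le_mul_of_nonneg_right h1 (by positivity)
    _ = ε := by field_simp

theorem outputProb_onlineQuantumPerceptron_le {d : Fin N → Example D} {c γ ε : ℝ} (hc : 1 < c)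
    (hγ : 0 < γ) (hε : 0 < ε) (hd : UnitWithMargin γ d) (ψ : State N Unit) (hψ : ‖ψ‖ = 1) :
    (onlineQuantumPerceptron N D c γ ε).outputProb d (badWeights d) ψ ≤ ε := by
  obtain ⟨h1, u, hu, hm⟩ := hd
  refine (outputProb_train_le hc hγ hε h1 hu hm _ 0 (zero_add _) 0
    (updateBound_zero u γ) ψ).trans ?_
  rw [hψ, one_pow, mul_one]
  exact floor_mul_le hγ hε

/-! ### Query complexity of the online quantum perceptron -/

theorem maxQueries_attempt_le (d : Fin N → Example D) (w : Vec D) (M : ℕ)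
    {found : Example D → QProg N D Unit} {next : QProg N D Unit} {B : ℕ}
    (hfound : ∀ x, (found x).maxQueries d ≤ B) (hnext : next.maxQueries d ≤ B) :
    (attempt w M found next).maxQueries d ≤ M + 1 + B := by
  simp only [attempt, QProg.maxQueries, maxQueries_groverSteps]
  refine Finset.sup_le fun m _ => ?_
  have h1 : (m : ℕ) ≤ M := Nat.lt_succ_iff.1 m.2
  rw [add_assoc]
  refine add_le_add h1 (Finset.sup_le fun q _ => ?_)
  rw [add_comm]
  refine Nat.add_le_add_left ?_ 1
  split_ifs
  · exact hfound _
  · exact hnext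

theorem maxQueries_attempts_le (d : Fin N → Example D) (w : Vec D)
    {found : Example D → QProg N D Unit} {notFound : QProg N D Unit} {B : ℕ}
    (hfound : ∀ x, (found x).maxQueries d ≤ B) (hnot : notFound.maxQueries d ≤ B)
    (Ms : List ℕ) :
    (attempts w found notFound Ms).maxQueries d ≤ (Ms.map fun M => M + 1).sum + B := by
  induction Ms with
  | nil => simpa [attempts] using hnot
  | cons M Ms ih =>
    rw [attempts, List.map_cons, List.sum_cons, add_assoc]
    exact maxQueries_attempt_le d w M (fun x => (hfound x).trans (Nat.le_add_left _ _)) ih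

theorem maxQueries_train_le (d : Fin N → Example D) (c γ ε : ℝ) (n : ℕ) (w : Vec D) :
    (train c γ ε n w : QProg N D Unit).maxQueries d ≤
      n * ((schedule N c γ ε).map fun M => M + 1).sum := by
  induction n generalizing w with
  | zero => simp [train, QProg.maxQueries]
  | succ n ih =>
    rw [train, Nat.succ_mul, add_comm]
    exact maxQueries_attempts_le d w (fun x => ih _) (by simp [QProg.maxQueries]) _

/-- The ceiling costs at most one factor `c`, and `N / (2 √(N - 1)) ≤ √N` for `N ≥ 2`. -/
theorem pow_innerLength_le {c : ℝ} (hc : 1 < c) : c ^ innerLength N c ≤ c * √(N : ℝ) := by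
  have hN : 1 ≤ N := NeZero.one_le
  have h1 : (1 : ℝ) ≤ N := by exact_mod_cast hN
  have hS : 1 ≤ √(N : ℝ) := Real.one_le_sqrt.2 h1
  have hc0 : 0 < c := by linarith
  rw [innerLength, one_div_sin_two_mul_arcsin hN]
  rcases le_total 1 ⌈Real.logb c (N / (2 * √((N : ℝ) - 1)))⌉₊ with h | h
  · rw [max_eq_right h]
    have hlog : 0 < Real.logb c (N / (2 * √((N : ℝ) - 1))) := Nat.ceil_pos.1 h
    have hN2 : (2 : ℝ) ≤ N := by
      rcases hN.eq_or_lt with h2 | h2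
      -- For `N = 1` the quotient is `1 / 0 = 0` and its logarithm is `0`, so this branch is void.
      · rw [← h2] at hlog; simp at hlog
      · exact_mod_cast h2
    have hR : 0 < √((N : ℝ) - 1) := Real.sqrt_pos.2 (by linarith)
    have hpos : 0 < (N : ℝ) / (2 * √((N : ℝ) - 1)) := by positivity
    rw [← Real.rpow_natCast]
    refine (Real.rpow_le_rpow_of_exponent_le hc.le (Nat.ceil_lt_add_one hlog.le).le).trans ?_
    rw [Real.rpow_add hc0, Real.rpow_one, Real.rpow_logb hc0 hc.ne' hpos, mul_comm]
    refine mul_le_mul_of_nonneg_left ?_ hc0.le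
    rw [div_le_iff₀ (by positivity)]
    have h3 : √(N : ℝ) ≤ 2 * √((N : ℝ) - 1) := by
      rw [Real.sqrt_le_iff]
      refine ⟨by positivity, ?_⟩
      rw [mul_pow, Real.sq_sqrt (by linarith)]
      linarith
    calc (N : ℝ) = √(N : ℝ) * √(N : ℝ) := (Real.mul_self_sqrt (by linarith)).symm
      _ ≤ _ := mul_le_mul_of_nonneg_left h3 (by linarith)
  · rw [max_eq_left h, pow_one]
    exact le_mul_of_one_le_right hc0.le hS

/-- Geometric sum: an attempt costs at most `⌈c ^ j⌉ + 1 ≤ 3 c ^ j` queries, the final one being the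
look-up. -/
theorem sum_ceil_pow_le {c : ℝ} (hc : 1 < c) (l : ℕ) :
    (((((List.range' 1 l).map fun j => ⌈c ^ j⌉₊).map fun M => M + 1).sum : ℕ) : ℝ) ≤
      3 * c / (c - 1) * c ^ l := by
  have hc1 : 0 < c - 1 := by linarith
  induction l with
  | zero =>
    simp only [List.range'_zero, List.map_nil, List.sum_nil, Nat.cast_zero]
    positivity
  | succ l ih =>
    rw [List.range'_concat, List.map_append, List.map_append, List.sum_append, Nat.cast_add]
    simp only [List.map_cons, List.map_nil, List.sum_cons, List.sum_nil, one_mul, add_zero]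
    have h1 : (⌈c ^ (1 + l)⌉₊ : ℝ) < c ^ (1 + l) + 1 := Nat.ceil_lt_add_one (by positivity)
    have h2 : 1 ≤ c ^ (1 + l) := one_le_pow₀ hc.le
    have h3 : 3 * c / (c - 1) * c ^ (l + 1) = 3 * c / (c - 1) * c ^ l + 3 * c ^ (1 + l) := by
      field_simp
      ring
    rw [h3, Nat.cast_add_one]
    linarith

theorem sum_schedule_le {c γ ε : ℝ} (hc : 1 < c) (hγ : 0 < γ) (hε : 0 < ε)
    (h : ε * γ ^ 2 ≤ 1 / 2) :
    ((((schedule N c γ ε).map fun M => M + 1).sum : ℕ) : ℝ) ≤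
      (1 / Real.log (4 / 3) + 1 / Real.log 2) * (3 * c / (c - 1) * c) *
        (√(N : ℝ) * Real.log (1 / (ε * γ ^ 2))) := by
  have hpos : 0 < ε * γ ^ 2 := by positivity
  have hl2 : 0 < Real.log 2 := Real.log_pos one_lt_two
  have hl43 : 0 < Real.log (4 / 3) := Real.log_pos (by norm_num)
  have hl : Real.log 2 ≤ Real.log (1 / (ε * γ ^ 2)) := by
    refine Real.log_le_log two_pos ?_
    rw [le_div_iff₀ hpos]
    linarith
  have hK : (⌈Real.logb (3 / 4) (γ ^ 2 * ε)⌉₊ : ℝ) ≤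
      (1 / Real.log (4 / 3) + 1 / Real.log 2) * Real.log (1 / (ε * γ ^ 2)) := by
    have h1 : Real.logb (3 / 4) (γ ^ 2 * ε) =
        1 / Real.log (4 / 3) * Real.log (1 / (ε * γ ^ 2)) := by
      have h3 : Real.log (3 / 4) = -Real.log (4 / 3) := by
        rw [← Real.log_inv]; norm_num
      rw [Real.logb, h3, one_div (ε * γ ^ 2), Real.log_inv, mul_comm (γ ^ 2)]
      field_simp
    -- The assumption `ε γ² ≤ 1/2` lets the logarithm absorb the `+ 1` from the ceiling.
    have h2 : 1 ≤ 1 / Real.log 2 * Real.log (1 / (ε * γ ^ 2)) := by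
      rw [one_div_mul_eq_div]
      exact (one_le_div hl2).2 hl
    have h4 : 0 ≤ Real.logb (3 / 4) (γ ^ 2 * ε) := by
      rw [h1]
      exact mul_nonneg (by positivity) (by linarith)
    have h5 := Nat.ceil_lt_add_one h4
    rw [h1] at h5
    rw [h1]
    linarith
  set block := (List.range' 1 (innerLength N c)).map fun j => ⌈c ^ j⌉₊ with hblock
  have h2 : ((schedule N c γ ε).map fun M => M + 1).sum =
      ⌈Real.logb (3 / 4) (γ ^ 2 * ε)⌉₊ * (block.map fun M => M + 1).sum := by
    rw [schedule, ← hblock, List.map_flatten, List.sum_flatten, List.map_replicate,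
      List.map_replicate, List.sum_replicate, smul_eq_mul]
  have hc1 : 0 < c - 1 := by linarith
  have h3 : (((block.map fun M => M + 1).sum : ℕ) : ℝ) ≤ 3 * c / (c - 1) * (c * √(N : ℝ)) :=
    (sum_ceil_pow_le hc _).trans
      (mul_le_mul_of_nonneg_left (pow_innerLength_le hc) (by positivity))
  rw [h2, Nat.cast_mul]
  refine (mul_le_mul hK h3 (Nat.cast_nonneg _) (mul_nonneg (by positivity) (by linarith))).trans
    (le_of_eq (by ring))

theorem maxQueries_onlineQuantumPerceptron_le {c γ ε : ℝ} (hc : 1 < c) (hγ : 0 < γ) (hε : 0 < ε)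
    (h : ε * γ ^ 2 ≤ 1 / 2) (d : Fin N → Example D) :
    ((onlineQuantumPerceptron N D c γ ε).maxQueries d : ℝ) ≤
      (1 / Real.log (4 / 3) + 1 / Real.log 2) * (3 * c / (c - 1) * c) *
        (√(N : ℝ) / γ ^ 2 * Real.log (1 / (ε * γ ^ 2))) := by
  have h1 : ((onlineQuantumPerceptron N D c γ ε).maxQueries d : ℝ) ≤
      (⌊1 / γ ^ 2⌋₊ : ℝ) * ((((schedule N c γ ε).map fun M => M + 1).sum : ℕ) : ℝ) := by
    rw [onlineQuantumPerceptron]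
    exact_mod_cast maxQueries_train_le d c γ ε _ 0
  have h2 : (⌊1 / γ ^ 2⌋₊ : ℝ) ≤ 1 / γ ^ 2 := Nat.floor_le (by positivity)
  refine h1.trans ((mul_le_mul h2 (sum_schedule_le hc hγ hε h) (Nat.cast_nonneg _)
    (by positivity)).trans (le_of_eq (by ring)))

end Training

/-! ### The classical perceptron -/

section ClassicalTraining

variable {N D : ℕ}

/-- Sample at most `k` vectors until one is misclassified by `w`. -/
def sampleUntil (w : Vec D) (found : Example D → CProg D) : ℕ → CProg D
  | 0 => .output w
  | k + 1 => .query w fun x b => if b then found x else sampleUntil w found k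

/-- The online perceptron with `K` samples for each of at most `n` updates. -/
def sampleTrain (K : ℕ) : ℕ → Vec D → CProg D
  | 0, w => .output w
  | n + 1, w => sampleUntil w (fun x => sampleTrain K n (update w x)) K

theorem maxQueries_sampleUntil_le (d : Fin N → Example D) (w : Vec D)
    {found : Example D → CProg D} {B : ℕ} (hfound : ∀ x, (found x).maxQueries d ≤ B) (k : ℕ) :
    (sampleUntil w found k).maxQueries d ≤ k + B := by
  induction k with
  | zero => simp [sampleUntil, CProg.maxQueries]
  | succ k ih =>
    simp only [sampleUntil, CProg.maxQueries]
    rw [add_right_comm]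
    refine Nat.add_le_add_right (Finset.sup_le fun i _ => ?_) 1
    split_ifs
    · exact (hfound _).trans (Nat.le_add_left _ _)
    · exact ih

theorem maxQueries_sampleTrain_le (d : Fin N → Example D) (K n : ℕ) (w : Vec D) :
    (sampleTrain K n w).maxQueries d ≤ n * K := by
  induction n generalizing w with
  | zero => simp [sampleTrain, CProg.maxQueries]
  | succ n ih =>
    rw [sampleTrain, Nat.succ_mul, add_comm]
    exact maxQueries_sampleUntil_le d w (fun x => ih _) K

theorem outputProb_sampleUntil_eq_zero (d : Fin N → Example D) {w : Vec D}
    (hw : w ∉ badWeights d) (found : Example D → CProg D) (k : ℕ) :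
    (sampleUntil w found k).outputProb d (badWeights d) = 0 := by
  have h : ∀ i, ¬ Misclassifies w (d i) := fun i hi => hw ⟨i, hi⟩
  induction k with
  | zero => simp [sampleUntil, CProg.outputProb, hw]
  | succ k ih => simp [sampleUntil, CProg.outputProb, h, ih]

variable [NeZero N]

/-- Failure within the round requires that all `k` samples avoid one fixed misclassified address. -/
theorem outputProb_sampleUntil_le (d : Fin N → Example D) {w : Vec D} (hw : w ∈ badWeights d)
    {found : Example D → CProg D} {a : ℝ} (ha : 0 ≤ a)
    (hfound : ∀ q, Misclassifies w (d q) → (found (d q)).outputProb d (badWeights d) ≤ a)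
    (k : ℕ) :
    (sampleUntil w found k).outputProb d (badWeights d) ≤ a + (1 - 1 / (N : ℝ)) ^ k := by
  classical
  have hN : (1 : ℝ) ≤ N := by exact_mod_cast (NeZero.one_le : 1 ≤ N)
  have hN0 : (0 : ℝ) < N := by linarith
  have hr : 0 ≤ 1 - 1 / (N : ℝ) := sub_nonneg.2 ((div_le_one hN0).2 hN)
  induction k with
  | zero => simp [sampleUntil, CProg.outputProb, hw, ha]
  | succ k ih =>
    obtain ⟨j, hj⟩ := hw
    have hrk := pow_nonneg hr k
    simp only [sampleUntil, CProg.outputProb]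
    rw [div_le_iff₀ hN0]
    -- The draw `j` contributes at most `a`, every other draw at most `a + (1 - 1/N) ^ k`.
    calc _ ≤ ∑ i, ((a + (1 - 1 / (N : ℝ)) ^ k) -
          if i = j then (1 - 1 / (N : ℝ)) ^ k else 0) := by
          refine Finset.sum_le_sum fun i _ => ?_
          by_cases hi : Misclassifies w (d i)
          · have := hfound i hi
            simp only [hi, decide_true, if_true]
            split_ifs <;> linarith
          · have hij : i ≠ j := fun h => hi (h ▸ hj)
            simpa [hi, hij] using ih
      _ = _ := by
          rw [Finset.sum_sub_distrib, Finset.sum_const, Finset.card_univ, Fintype.card_fin,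
            Finset.sum_ite_eq' Finset.univ j, if_pos (Finset.mem_univ _), nsmul_eq_mul, pow_succ]
          generalize (1 - 1 / (N : ℝ)) ^ k = x
          field_simp
          ring

theorem outputProb_sampleTrain_le {d : Fin N → Example D} {u : Vec D} {γ δ : ℝ} {K : ℕ}
    (hγ : 0 < γ) (hδ : 0 ≤ δ) (hK : (1 - 1 / (N : ℝ)) ^ K ≤ δ) (hd : ∀ i, ‖(d i).1‖ = 1)
    (hu : ‖u‖ = 1) (hm : ∀ i, γ ≤ label (d i) * inner ℝ u (d i).1) (n k : ℕ)
    (hnk : k + n = ⌊1 / γ ^ 2⌋₊) (w : Vec D) (hw : UpdateBound u γ k w) :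
    (sampleTrain K n w).outputProb d (badWeights d) ≤ n * δ := by
  induction n generalizing k w with
  | zero =>
    rw [add_zero] at hnk
    rw [hnk] at hw
    simp [sampleTrain, CProg.outputProb, hw.notMem_badWeights hd hu hγ hm]
  | succ n ih =>
    rw [sampleTrain]
    by_cases hb : w ∈ badWeights d
    · have := outputProb_sampleUntil_le d hb (a := n * δ) (by positivity)
        (found := fun x => sampleTrain K n (update w x))
        (fun q hq => ih (k + 1) (by omega) _ (hw.update (hd q) (hm q) hq)) K
      push_cast
      linarith
    · rw [outputProb_sampleUntil_eq_zero d hb]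
      positivity

/-- From `1 - x ≤ exp (-x)` at `x = 1 / N`; this dictates the number of samples per round. -/
theorem one_sub_inv_pow_ceil_le {δ : ℝ} (hδ : 0 < δ) :
    (1 - 1 / (N : ℝ)) ^ ⌈N * Real.log (1 / δ)⌉₊ ≤ δ := by
  have hN : (1 : ℝ) ≤ N := by exact_mod_cast (NeZero.one_le : 1 ≤ N)
  have hN0 : (0 : ℝ) < N := by linarith
  have hr : 0 ≤ 1 - 1 / (N : ℝ) := sub_nonneg.2 ((div_le_one hN0).2 hN)
  refine (pow_le_pow_left₀ hr (Real.one_sub_le_exp_neg _) _).trans ?_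
  rw [← Real.exp_nat_mul, ← Real.le_log_iff_exp_le hδ]
  have h1 := Nat.le_ceil (N * Real.log (1 / δ))
  rw [one_div δ, Real.log_inv] at h1 ⊢
  have h2 : (⌈(N : ℝ) * -Real.log δ⌉₊ : ℝ) * -(1 / (N : ℝ)) =
      -((⌈(N : ℝ) * -Real.log δ⌉₊ : ℝ) / N) := by ring
  rw [h2, neg_le, le_div_iff₀ hN0]
  linarith

end ClassicalTraining

/-! ### The two upper bounds -/

theorem quantum_upper_bound (c : ℝ) (hc : 1 < c) : ∃ C : ℝ, 0 < C ∧
    ∀ (N D : ℕ) [NeZero N] (γ ε : ℝ), 0 < γ → 0 < ε → ε < 1 → ε * γ ^ 2 ≤ 1 / 2 →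
      ∀ d : Fin N → Example D, UnitWithMargin γ d →
        ((onlineQuantumPerceptron N D c γ ε).maxQueries d : ℝ)
            ≤ C * (√(N : ℝ) / γ ^ 2 * Real.log (1 / (ε * γ ^ 2))) ∧
          ∀ ψ : State N Unit, ‖ψ‖ = 1 →
            (onlineQuantumPerceptron N D c γ ε).outputProb d (badWeights d) ψ ≤ ε := by
  refine ⟨(1 / Real.log (4 / 3) + 1 / Real.log 2) * (3 * c / (c - 1) * c), ?_, ?_⟩
  · have : 0 < c - 1 := by linarith
    have : 0 < Real.log 2 := Real.log_pos one_lt_two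
    have : 0 < Real.log (4 / 3) := Real.log_pos (by norm_num)
    positivity
  · intro N D _ γ ε hγ hε _ h d hd
    exact ⟨maxQueries_onlineQuantumPerceptron_le hc hγ hε h d,
      fun ψ hψ => outputProb_onlineQuantumPerceptron_le hc hγ hε hd ψ hψ⟩

theorem classical_upper_bound : ∃ C : ℝ, 0 < C ∧
    ∀ (N D : ℕ) (γ ε : ℝ), 1 ≤ N → 0 < γ → 0 < ε → ε < 1 → ε * γ ^ 2 ≤ 1 / 2 →
      ∃ A : CProg D, ∀ d : Fin N → Example D, UnitWithMargin γ d →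
        (A.maxQueries d : ℝ) ≤ C * ((N : ℝ) / γ ^ 2 * Real.log (1 / (ε * γ ^ 2))) ∧
          A.outputProb d (badWeights d) ≤ ε := by
  have hl2 : 0 < Real.log 2 := Real.log_pos one_lt_two
  refine ⟨1 + 1 / Real.log 2, by positivity, ?_⟩
  intro N D γ ε hN hγ hε _ h
  have : NeZero N := ⟨by omega⟩
  have hN' : (1 : ℝ) ≤ N := by exact_mod_cast hN
  have hpos : 0 < ε * γ ^ 2 := by positivity
  have hl : Real.log 2 ≤ Real.log (1 / (ε * γ ^ 2)) := by
    refine Real.log_le_log two_pos ?_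
    rw [le_div_iff₀ hpos]
    linarith
  -- With `⌈N log (1 / (ε γ²))⌉` samples per round, a round fails with probability at most `ε γ²`,
  -- and there are at most `1 / γ²` rounds.
  refine ⟨sampleTrain ⌈N * Real.log (1 / (ε * γ ^ 2))⌉₊ ⌊1 / γ ^ 2⌋₊ 0, fun d hd => ⟨?_, ?_⟩⟩
  · have h1 : ((sampleTrain ⌈N * Real.log (1 / (ε * γ ^ 2))⌉₊ ⌊1 / γ ^ 2⌋₊
        (0 : Vec D)).maxQueries d : ℝ) ≤
        (⌊1 / γ ^ 2⌋₊ : ℝ) * (⌈N * Real.log (1 / (ε * γ ^ 2))⌉₊ : ℝ) := by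
      exact_mod_cast maxQueries_sampleTrain_le d _ _ _
    have h2 : (⌊1 / γ ^ 2⌋₊ : ℝ) ≤ 1 / γ ^ 2 := Nat.floor_le (by positivity)
    have hNl : Real.log 2 ≤ N * Real.log (1 / (ε * γ ^ 2)) :=
      hl.trans (le_mul_of_one_le_left (by linarith) hN')
    have h3 : (⌈N * Real.log (1 / (ε * γ ^ 2))⌉₊ : ℝ) ≤
        (1 + 1 / Real.log 2) * (N * Real.log (1 / (ε * γ ^ 2))) := by
      have h4 := Nat.ceil_lt_add_one (hl2.le.trans hNl)
      have h5 : 1 ≤ 1 / Real.log 2 * (N * Real.log (1 / (ε * γ ^ 2))) := by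
        rw [one_div_mul_eq_div]
        exact (one_le_div hl2).2 hNl
      linarith
    refine h1.trans ((mul_le_mul h2 h3 (Nat.cast_nonneg _) (by positivity)).trans
      (le_of_eq (by ring)))
  · obtain ⟨h1, u, hu, hm⟩ := hd
    refine (outputProb_sampleTrain_le hγ hpos.le (one_sub_inv_pow_ceil_le hpos) h1 hu hm _ 0
      (zero_add _) 0 (updateBound_zero u γ)).trans ?_
    rw [mul_comm ε]
    exact floor_mul_le hγ hε

end QuantumPerceptron

end

theorem theorem1 :
    -- the online quantum perceptron: correctness and upper bound
    (∀ c : ℝ, 1 < c → c < 2 → ∃ C : ℝ, 0 < C ∧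
      ∀ (N D : ℕ) [NeZero N] (γ ε : ℝ), 0 < γ → 0 < ε → ε < 1 → ε * γ ^ 2 ≤ 1 / 2 →
        ∀ d : Fin N → Example D, UnitWithMargin γ d →
          ((onlineQuantumPerceptron N D c γ ε).maxQueries d : ℝ)
              ≤ C * (√(N : ℝ) / γ ^ 2 * Real.log (1 / (ε * γ ^ 2))) ∧
            ∀ ψ : State N Unit, ‖ψ‖ = 1 →
              (onlineQuantumPerceptron N D c γ ε).outputProb d (badWeights d) ψ ≤ ε) ∧
    -- lower bound for all quantum algorithms
    (∀ ε₀ : ℝ, ε₀ < 1 / 2 → ∃ κ : ℝ, 0 < κ ∧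
      ∀ (N D : ℕ), 1 ≤ N → 2 ≤ D → ∀ γ ε : ℝ, 0 < γ → γ ≤ 1 / √2 → 0 < ε → ε ≤ ε₀ →
        ∀ (W : Type) [Fintype W] (A : QProg N D W) (ψ : State N W), ‖ψ‖ = 1 →
          (∀ d : Fin N → Example D, UnitWithMargin γ d → A.outputProb d (badWeights d) ψ ≤ ε) →
          ∃ d : Fin N → Example D, UnitWithMargin γ d ∧ κ * √(N : ℝ) ≤ A.expectedQueries d ψ) ∧
    -- classical upper bound
    (∃ C : ℝ, 0 < C ∧
      ∀ (N D : ℕ) (γ ε : ℝ), 1 ≤ N → 0 < γ → 0 < ε → ε < 1 → ε * γ ^ 2 ≤ 1 / 2 →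
        ∃ A : CProg D, ∀ d : Fin N → Example D, UnitWithMargin γ d →
          (A.maxQueries d : ℝ) ≤ C * ((N : ℝ) / γ ^ 2 * Real.log (1 / (ε * γ ^ 2))) ∧
            A.outputProb d (badWeights d) ≤ ε) ∧
    -- lower bound for all classical algorithms
    (∀ ε₀ : ℝ, ε₀ < 1 / 2 → ∃ κ : ℝ, 0 < κ ∧
      ∀ (N D : ℕ), 1 ≤ N → 2 ≤ D → ∀ γ ε : ℝ, 0 < γ → γ ≤ 1 / √2 → 0 < ε → ε ≤ ε₀ →
        ∀ A : CProg D,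
          (∀ d : Fin N → Example D, UnitWithMargin γ d → A.outputProb d (badWeights d) ≤ ε) →
          ∃ d : Fin N → Example D, UnitWithMargin γ d ∧
            κ * (N : ℝ) ≤ A.expectedQueries d) :=
  ⟨fun c hc _ => quantum_upper_bound c hc, quantum_lower_bound, classical_upper_bound,
    classical_lower_bound⟩
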